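/- For $p\in\mathbb N$, a $p$-labeled rooted tree is a structure over the vocabulary $\{E,\mathsf{root},P_1,\dots,P_p\}$ (of arbitrary cardinality, finite or infinite) whose $\{E\}$-reduct is a tree (a connected acyclic simple graph), in which $\mathsf{root}$ holds of exactly one node, called the root, and in which the (possibly empty) sets $P_1,\dots,P_p$ partition the nodes. A leaf is a node without children; the height of a tree is the supremum of the distances of its nodes from the root. A tree $\mathfrak t'$ is a leaf-hereditary subtree of $\mathfrak t$ if it is an induced substructure of $\mathfrak t$, has the same root, and every leaf of $\mathfrak t'$ is a leaf of $\mathfrak t$. Let $\mathcal T_{d,p}$ be the class of all (finite or infinite) $p$-labeled rooted trees of height at most $d$. Write $\mathfrak t'\equiv_m\mathfrak t$ if $\mathfrak t'$ and $\mathfrak t$ satisfy the same monadic second-order (MSO) sentences of quantifier rank at most $m$, where first-order and set quantifiers both count towards the rank. Let $\mathsf{tower}(0,x)=x$ and $\mathsf{tower}(d+1,x)=2^{\mathsf{tower}(d,x)}$ for real $x$, and let $\log$ be the logarithm in base $2$ (with $\log 0$ read as $0$; for $p=0$ there are no $p$-labeled rooted trees). **Theorem.** There is a strictly increasing function $g:\mathbb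 N\to\mathbb N$ such that, with $$\zeta_{d,p}(n_1,n_2)=\mathsf{tower}\bigl(n_2,\;g(d)\,(n_1+1)\,(n_1+\log p)\bigr),$$ the following hold for all $d,p\in\mathbb N$ and all integers $m\ge 1$. 1. Every tree $\mathfrak t\in\mathcal T_{d,p}$ has a leaf-hereditary subtree $\mathfrak t'$ such that (i) $\mathfrak t'$ and $\mathfrak t$ have the same height, (ii) $\mathfrak t'$ is finite with at most $\zeta_{d,p}(m,d)$ nodes, and (iii) $\mathfrak t'\equiv_m\mathfrak t$. 2. The number of equivalence classes of $\equiv_m$ on $\mathcal T_{d,p}$ is finite; it is at most $\zeta_{d,p}(m,d+1)$ if $d\ge 1$, and it equals $p$ if $d=0$. -/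

import Mathlib

universe u

/-- The tower function, `tower 0 x = x` and `tower (d + 1) x = 2 ^ tower d x`, on real arguments
(the argument contains a logarithm). -/
noncomputable def tower : ℕ → ℝ → ℝ
  | 0, x => x
  | d + 1, x => (2 : ℝ) ^ tower d x

/-- A `p`-labeled rooted tree, of any cardinality. The predicate `root` is interpreted by the
singleton of the node `root`, and `P i` by the set of the nodes of label `i`; so the sets `P i`
partition the nodes, and some of them may be empty. -/
structure LabeledTree (p : ℕ) where
  V : Type u
  graph : SimpleGraph V
  isTree : graph.IsTree
  root : V
  label : V → Fin p

namespace LabeledTree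

variable {p : ℕ}

/-- The distance of a node from the root. -/
noncomputable def depth (t : LabeledTree.{u} p) (v : t.V) : ℕ := t.graph.dist t.root v

/-- The node `w` is a child of the node `v`. -/
def IsChild (t : LabeledTree.{u} p) (w v : t.V) : Prop :=
  t.graph.Adj v w ∧ t.depth w = t.depth v + 1

/-- A leaf is a node without children (so the root of a one-node tree is a leaf). -/
def IsLeaf (t : LabeledTree.{u} p) (v : t.V) : Prop := ∀ w, ¬ t.IsChild w v

/-- The height: the supremum of the distances of the nodes from the root. -/
noncomputable def height (t : LabeledTree.{u} p) : ℕ∞ := ⨆ v : t.V, (t.depth v : ℕ∞)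

/-- A set of nodes that contains the root and induces a connected subgraph. -/
structure Subtree (t : LabeledTree.{u} p) where
  nodes : Set t.V
  root_mem : t.root ∈ nodes
  connected : (t.graph.induce nodes).Connected

namespace Subtree

variable {t : LabeledTree.{u} p}

/-- The induced substructure on the nodes of a subtree, which is a labeled rooted tree with the
same root. -/
def toTree (s : t.Subtree) : LabeledTree.{u} p where
  V := s.nodes
  graph := t.graph.induce s.nodes
  isTree := ⟨s.connected, t.isTree.isAcyclic.induce s.nodes⟩
  root := ⟨t.root, s.root_mem⟩
  label v := t.label v.1

/-- Every leaf of the subtree is a leaf of the whole tree. -/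
def IsLeafHereditary (s : t.Subtree) : Prop :=
  ∀ v : s.nodes, s.toTree.IsLeaf v → t.IsLeaf v.1

end Subtree

end LabeledTree

/-- Formulas of monadic second-order logic over the vocabulary `{E, root, P_1, ..., P_p}`, with
`n` free element variables and `k` free set variables; a quantifier binds the new variable of
index `0`. The other connectives and the universal quantifiers are the usual abbreviations, which
do not change the quantifier rank. -/
inductive MSOFormula (p : ℕ) : ℕ → ℕ → Type
  | falsum {n k : ℕ} : MSOFormula p n k
  | eq {n k : ℕ} (x y : Fin n) : MSOFormula p n k
  | edge {n k : ℕ} (x y : Fin n) : MSOFormula p n k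
  | root {n k : ℕ} (x : Fin n) : MSOFormula p n k
  | label {n k : ℕ} (i : Fin p) (x : Fin n) : MSOFormula p n k
  | mem {n k : ℕ} (x : Fin n) (X : Fin k) : MSOFormula p n k
  | neg {n k : ℕ} (φ : MSOFormula p n k) : MSOFormula p n k
  | and {n k : ℕ} (φ ψ : MSOFormula p n k) : MSOFormula p n k
  | exElem {n k : ℕ} (φ : MSOFormula p (n + 1) k) : MSOFormula p n k
  | exSet {n k : ℕ} (φ : MSOFormula p n (k + 1)) : MSOFormula p n k

namespace MSOFormula

variable {p : ℕ}

/-- The quantifier rank: the maximal number of nested quantifiers, of both kinds. -/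
def rank : {n k : ℕ} → MSOFormula p n k → ℕ
  | _, _, falsum => 0
  | _, _, eq _ _ => 0
  | _, _, edge _ _ => 0
  | _, _, root _ => 0
  | _, _, label _ _ => 0
  | _, _, mem _ _ => 0
  | _, _, neg φ => φ.rank
  | _, _, and φ ψ => max φ.rank ψ.rank
  | _, _, exElem φ => φ.rank + 1
  | _, _, exSet φ => φ.rank + 1

/-- Satisfaction in a tree, under an assignment `a` of nodes to the element variables and an
assignment `A` of sets of nodes to the set variables. -/
def Sat (t : LabeledTree.{u} p) :
    {n k : ℕ} → MSOFormula p n k → (Fin n → t.V) → (Fin k → Set t.V) → Prop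
  | _, _, falsum, _, _ => False
  | _, _, eq x y, a, _ => a x = a y
  | _, _, edge x y, a, _ => t.graph.Adj (a x) (a y)
  | _, _, root x, a, _ => a x = t.root
  | _, _, label i x, a, _ => t.label (a x) = i
  | _, _, mem x X, a, A => a x ∈ A X
  | _, _, neg φ, a, A => ¬ Sat t φ a A
  | _, _, and φ ψ, a, A => Sat t φ a A ∧ Sat t ψ a A
  | _, _, exElem φ, a, A => ∃ v : t.V, Sat t φ (Fin.cons v a) A
  | _, _, exSet φ, a, A => ∃ S : Set t.V, Sat t φ a (Fin.cons S A)

end MSOFormula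

namespace LabeledTree

variable {p : ℕ}

/-- `t₁` and `t₂` agree on all monadic second-order sentences of rank at most `m`. -/
def MSOEquiv (m : ℕ) (t₁ t₂ : LabeledTree.{u} p) : Prop :=
  ∀ φ : MSOFormula p 0 0, φ.rank ≤ m →
    (φ.Sat t₁ Fin.elim0 Fin.elim0 ↔ φ.Sat t₂ Fin.elim0 Fin.elim0)

/-- The class of the `p`-labeled rooted trees of height at most `d`. -/
def OfHeightLE (d p : ℕ) : Type (u + 1) := {t : LabeledTree.{u} p // t.height ≤ (d : ℕ∞)}

/-- Equivalence up to rank `m`, on the trees of height at most `d`. -/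
def msoSetoid (m d p : ℕ) : Setoid (OfHeightLE.{u} d p) where
  r t₁ t₂ := MSOEquiv m t₁.1 t₂.1
  iseqv :=
    { refl := fun _ _ _ => Iff.rfl
      symm := fun h φ hφ => (h φ hφ).symm
      trans := fun h₁ h₂ φ hφ => (h₁ φ hφ).trans (h₂ φ hφ) }

/-- The type of the equivalence classes; the index of the relation is the number of its
elements. -/
def MSOClasses (m d p : ℕ) : Type (u + 1) := Quotient (msoSetoid.{u} m d p)

end LabeledTree

/-- The function `ζ_{d,p}(n₁, n₂) = tower (n₂, g(d) · (n₁ + 1) · (n₁ + log p))`, with the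
logarithm in base `2`. -/
noncomputable def zeta (g : ℕ → ℕ) (d p n₁ n₂ : ℕ) : ℝ :=
  tower n₂ ((g d : ℝ) * ((n₁ : ℝ) + 1) * ((n₁ : ℝ) + Real.logb 2 (p : ℝ)))

/-!
A node of a tree gets a *counting type* (`CountType`, `LabeledTree.countType`): its type of level
`0` is its colour, and its type of level `j + 1` records the colour and, for each type `τ` of level
`j`, the number of children of type `τ`, counted up to a threshold `T j`. For suitable thresholds,
the type of level `d` of the root determines the sentences of rank at most `m` that hold in a tree
of height at most `d` (`LabeledTree.msoEquiv_of_countType_eq`). Counting types form a finite type,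
and the theorem is read off from its size.

That counting types determine the sentences is shown by a back-and-forth argument. A set variable is
treated as a refinement of the colouring by one bit, and an element variable as a singleton. Suppose
that the thresholds for the rank `m + 1` are the thresholds for the rank `m` times the number of
types for the rank `m` over the refined colours (`threshold`). If two trees have the same type for
the rank `m + 1`, and `S` is a set of nodes of the first tree, then a map from the second tree to
the first one is built from the root downwards: the children of a node are sent to children of its
image so that the refined types are hit with the right truncated numbers, which is possible by the
pigeonhole principle (`exists_map_truncCard_eq`). The preimage of `S` answers `S`
(`LabeledTree.exists_set_countType_eq`). All thresholds are at least two, so that types recognize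
colours which belong to a single node; hence singletons are answered by singletons, and the
adjacency of two nodes of unique colours can be read off.

A small subtree keeps, at each node and for each type, as many children of that type as there are,
up to the threshold (`LabeledTree.exists_subtree_countType_eq`). This preserves the types. A node
that has children keeps a child, so no new leaves arise.

For the bounds (`typeCount_and_threshold_le`), a set move trades one unit of the rank for a doubling
of the number `ℓ` of colours, which does not increase the quantity `(m + 1) * (m + 1 + log ℓ)`. The
product of the `m` numbers of types in a threshold at most multiplies the exponent by `m + 1`, which
is absorbed by a tower of height at least two; the level `0`, where the number of types is just `ℓ`,
produces the quadratic argument of the towers. Passing to the next level adds one exponential.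
-/

/-! ### Parents in a labeled rooted tree -/

namespace LabeledTree

variable {p : ℕ} {t : LabeledTree.{u} p}

lemma depth_eq_zero_iff {v : t.V} : t.depth v = 0 ↔ v = t.root := by
  rw [depth, t.isTree.connected.dist_eq_zero_iff, eq_comm]

lemma depth_root : t.depth t.root = 0 := depth_eq_zero_iff.2 rfl

lemma IsChild.ne_root {w v : t.V} (h : t.IsChild w v) : w ≠ t.root := by
  intro hw
  have := h.2
  rw [depth_eq_zero_iff.2 hw] at this
  omega

lemma adj_iff_isChild {v w : t.V} : t.graph.Adj v w ↔ t.IsChild w v ∨ t.IsChild v w := by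
  constructor
  · intro h
    rcases t.isTree.dist_eq_dist_add_one_of_adj t.root h with h' | h'
    · exact Or.inr ⟨h.symm, h'⟩
    · exact Or.inl ⟨h, h'⟩
  · rintro (h | h)
    · exact h.1
    · exact h.1.symm

lemma exists_isChild {w : t.V} (h : w ≠ t.root) : ∃ v, t.IsChild w v := by
  obtain ⟨q, hq⟩ := t.isTree.connected.exists_walk_length_eq_dist w t.root
  cases q with
  | nil => exact absurd rfl h
  | cons hadj q =>
    rename_i v
    refine ⟨v, hadj.symm, ?_⟩
    rcases adj_iff_isChild.1 hadj with h' | h'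
    · have h1 := SimpleGraph.dist_le q
      have h2 := h'.2
      rw [SimpleGraph.Walk.length_cons] at hq
      rw [depth, depth, SimpleGraph.dist_comm, SimpleGraph.dist_comm (v := w)] at h2
      omega
    · exact h'.2

lemma IsChild.unique {w v v' : t.V} (h : t.IsChild w v) (h' : t.IsChild w v') : v = v' := by
  obtain ⟨q, hq⟩ := t.isTree.connected.exists_walk_length_eq_dist t.root v
  obtain ⟨q', hq'⟩ := t.isTree.connected.exists_walk_length_eq_dist t.root v'
  have h1 : (q.concat h.1).IsPath := by
    apply SimpleGraph.Walk.isPath_of_length_eq_dist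
    rw [SimpleGraph.Walk.length_concat, hq]
    exact h.2.symm
  have h2 : (q'.concat h'.1).IsPath := by
    apply SimpleGraph.Walk.isPath_of_length_eq_dist
    rw [SimpleGraph.Walk.length_concat, hq']
    exact h'.2.symm
  exact (SimpleGraph.Walk.concat_inj
    ((t.isTree.existsUnique_path t.root w).unique h1 h2)).1

open Classical in
/-- The parent of a node; the root is its own parent. -/
noncomputable def parent (t : LabeledTree.{u} p) (w : t.V) : t.V :=
  if h : ∃ v, t.IsChild w v then h.choose else w

lemma IsChild.parent_eq {w v : t.V} (h : t.IsChild w v) : t.parent w = v := by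
  have h' : ∃ v, t.IsChild w v := ⟨v, h⟩
  rw [parent, dif_pos h']
  exact h'.choose_spec.unique h

lemma isChild_parent {w : t.V} (h : w ≠ t.root) : t.IsChild w (t.parent w) := by
  obtain ⟨v, hv⟩ := exists_isChild h
  rwa [hv.parent_eq]

lemma isChild_parent_of_depth {w : t.V} {n : ℕ} (h : t.depth w = n + 1) :
    t.IsChild w (t.parent w) ∧ t.depth (t.parent w) = n := by
  have h1 : w ≠ t.root := fun hw => by rw [depth_eq_zero_iff.2 hw] at h; omega
  have h2 := isChild_parent h1
  exact ⟨h2, by have := h2.2; omega⟩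

lemma depth_le_of_height_le {d : ℕ} (h : t.height ≤ (d : ℕ∞)) (v : t.V) : t.depth v ≤ d := by
  exact_mod_cast (le_iSup (fun v => (t.depth v : ℕ∞)) v).trans h

end LabeledTree

/-! ### Truncated cardinalities -/

section Trunc

open Set

variable {V V' : Type*}

/-- The cardinality of a set, counted up to the threshold `T`. -/
noncomputable def truncCard (T : ℕ) (s : Set V) : Fin (T + 1) :=
  ⟨(min s.encard T).toNat, by
    have : min s.encard (T : ℕ∞) ≤ T := min_le_right _ _
    have := ENat.toNat_le_toNat this (ENat.natCast_ne_top T)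
    rw [ENat.toNat_natCast] at this
    omega⟩

lemma truncCard_eq_iff {T : ℕ} {s : Set V} {s' : Set V'} :
    truncCard T s = truncCard T s' ↔ min s.encard (T : ℕ∞) = min s'.encard (T : ℕ∞) := by
  have h1 : min s.encard (T : ℕ∞) ≠ ⊤ :=
    ne_top_of_le_ne_top (ENat.natCast_ne_top T) (min_le_right _ _)
  have h2 : min s'.encard (T : ℕ∞) ≠ ⊤ :=
    ne_top_of_le_ne_top (ENat.natCast_ne_top T) (min_le_right _ _)
  rw [truncCard, truncCard, Fin.mk.injEq]
  refine ⟨fun h => ?_, fun h => by rw [h]⟩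
  rw [← ENat.natCast_toNat h1, ← ENat.natCast_toNat h2, h]

lemma encard_eq_sum_fibers {ι : Type*} [Fintype ι] (s : Set V) (f : V → ι) :
    s.encard = ∑ i, {x ∈ s | f x = i}.encard := by
  have hs : s = ⋃ i, {x ∈ s | f x = i} := by ext; simp
  conv_lhs => rw [hs]
  rw [encard_iUnion_of_finite, finsum_eq_sum_of_fintype]
  intro i j hij
  rw [Function.onFun, Set.disjoint_left]
  rintro x ⟨-, rfl⟩ ⟨-, h⟩
  exact hij h

/-- Truncated cardinalities of a set are determined by those of the fibres of a map on it to a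
finite type. -/
lemma truncCard_eq_of_fibers {ι : Type*} [Fintype ι] {T : ℕ} {s : Set V} {s' : Set V'}
    (f : V → ι) (f' : V' → ι)
    (h : ∀ i, truncCard T {x ∈ s | f x = i} = truncCard T {x ∈ s' | f' x = i}) :
    truncCard T s = truncCard T s' := by
  rw [truncCard_eq_iff, encard_eq_sum_fibers s f, encard_eq_sum_fibers s' f']
  simp only [truncCard_eq_iff] at h
  by_cases hs : ∃ i, (T : ℕ∞) ≤ {x ∈ s | f x = i}.encard
  · obtain ⟨i, hi⟩ := hs
    have hi' : (T : ℕ∞) ≤ {x ∈ s' | f' x = i}.encard := by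
      have := h i
      rw [min_eq_right hi] at this
      rw [this]
      exact min_le_left _ _
    rw [min_eq_right, min_eq_right]
    · exact hi'.trans (Finset.single_le_sum (f := fun i => {x ∈ s' | f' x = i}.encard)
        (fun _ _ => zero_le) (Finset.mem_univ i))
    · exact hi.trans (Finset.single_le_sum (f := fun i => {x ∈ s | f x = i}.encard)
        (fun _ _ => zero_le) (Finset.mem_univ i))
  · push Not at hs
    congr 1
    refine Finset.sum_congr rfl fun i _ => ?_
    have := h i
    rw [min_eq_left (hs i).le] at this
    rcases le_total {x ∈ s' | f' x = i}.encard (T : ℕ∞) with h' | h'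
    · rwa [min_eq_left h'] at this
    · rw [min_eq_right h'] at this
      exact absurd this (hs i).ne

/-- If the threshold of a colour count is `T'` and there are `card K` colours, a set can imitate
the colouring of another set as soon as the two cardinalities agree up to `card K * T'`. -/
lemma exists_map_truncCard_eq {K : Type*} [Fintype K] [Nonempty V] {T' : ℕ} (hT' : 1 ≤ T')
    (c : V → K) (s : Set V) (s' : Set V')
    (h : truncCard (Fintype.card K * T') s = truncCard (Fintype.card K * T') s') :
    ∃ F : V' → V, MapsTo F s' s ∧
      ∀ k, truncCard T' {x ∈ s | c x = k} = truncCard T' {x ∈ s' | c (F x) = k} := by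
  classical
  simp only [truncCard_eq_iff] at h ⊢
  by_cases hs : s.encard < ((Fintype.card K * T' : ℕ) : ℕ∞)
  -- A set below the threshold is finite and in bijection with the other one.
  · have h1 : s'.encard = s.encard := by
      rw [min_eq_left hs.le] at h
      rcases le_total s'.encard ((Fintype.card K * T' : ℕ) : ℕ∞) with h' | h'
      · rw [min_eq_left h'] at h; exact h.symm
      · rw [min_eq_right h'] at h; exact absurd h hs.ne
    have hfin : s'.Finite := by
      rw [← encard_lt_top_iff, h1]
      exact hs.trans (ENat.natCast_lt_top _)
    obtain ⟨F, hF⟩ := hfin.exists_bijOn_of_encard_eq h1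
    refine ⟨F, hF.mapsTo, fun k => ?_⟩
    congr 1
    have : {x ∈ s | c x = k} = F '' {x ∈ s' | c (F x) = k} := by
      ext x
      constructor
      · rintro ⟨hx, hk⟩
        obtain ⟨y, hy, rfl⟩ := hF.surjOn hx
        exact ⟨y, ⟨hy, hk⟩, rfl⟩
      · rintro ⟨y, ⟨hy, hk⟩, rfl⟩
        exact ⟨hF.mapsTo hy, hk⟩
    rw [this, (hF.injOn.mono (sep_subset _ _)).encard_image]
  · have hs := not_lt.1 hs
    have hs' : ((Fintype.card K * T' : ℕ) : ℕ∞) ≤ s'.encard := by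
      rw [min_eq_right hs] at h
      rw [h]
      exact min_le_left _ _
    -- By the pigeonhole principle some colour occurs at least `T'` times.
    obtain ⟨k₀, hk₀⟩ : ∃ k, (T' : ℕ∞) ≤ {x ∈ s | c x = k}.encard := by
      by_contra! hcon
      have h2 := (encard_eq_sum_fibers s c).le
      have h3 : ∑ k, {x ∈ s | c x = k}.encard ≤ ∑ _k : K, ((T' - 1 : ℕ) : ℕ∞) := by
        refine Finset.sum_le_sum fun k _ => ?_
        have h4 := hcon k
        have h5 := ENat.natCast_toNat (ne_top_of_lt h4)
        rw [← h5] at h4 ⊢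
        rw [Nat.cast_lt] at h4
        rw [Nat.cast_le]
        omega
      have h4 := (hs.trans h2).trans h3
      rw [Finset.sum_const, Finset.card_univ, nsmul_eq_mul, ← Nat.cast_mul, Nat.cast_le] at h4
      have hK : 0 < Fintype.card K := Fintype.card_pos_iff.2 ⟨c (Classical.arbitrary V)⟩
      have := Nat.le_of_mul_le_mul_left h4 hK
      omega
    -- Reserve in `s'` the required number of elements for each colour, up to `T'`, and give the
    -- colour `k₀` to the elements that are left over.
    let n : K → ℕ := fun k => (min {x ∈ s | c x = k}.encard (T' : ℕ∞)).toNat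
    have hn : ∀ k, ((n k : ℕ) : ℕ∞) = min {x ∈ s | c x = k}.encard (T' : ℕ∞) := fun k =>
      ENat.natCast_toNat (ne_top_of_le_ne_top (ENat.natCast_ne_top T') (min_le_right _ _))
    have hle : (univ : Set (Σ k, Fin (n k))).encard ≤ s'.encard := by
      rw [encard_univ, ENat.card_eq_coe_fintype_card, Fintype.card_sigma]
      refine le_trans ?_ hs'
      rw [Nat.cast_le]
      calc ∑ k, Fintype.card (Fin (n k)) ≤ ∑ _k : K, T' := by
            refine Finset.sum_le_sum fun k _ => ?_
            rw [Fintype.card_fin, ← Nat.cast_le (α := ℕ∞), hn]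
            exact min_le_right _ _
        _ = Fintype.card K * T' := by simp
    obtain ⟨Y, hYs, hY⟩ := exists_subset_encard_eq hle
    have : Nonempty V' := by
      have h0 : s'.encard ≠ 0 := by
        intro h0
        rw [h0] at hs'
        have h1 : Fintype.card K * T' = 0 := by exact_mod_cast le_antisymm hs' zero_le
        have hK : 0 < Fintype.card K := Fintype.card_pos_iff.2 ⟨k₀⟩
        have := Nat.mul_pos hK hT'
        omega
      obtain ⟨x, -⟩ := encard_ne_zero.1 h0
      exact ⟨x⟩
    obtain ⟨e, he⟩ := (finite_univ (α := Σ k, Fin (n k))).exists_bijOn_of_encard_eq hY.symm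
    have heinj : Function.Injective e := injOn_univ.1 he.injOn
    let col : V' → K := Function.extend e Sigma.fst (fun _ => k₀)
    have hcol : ∀ x, ∃ y ∈ s, c y = col x := by
      intro x
      have hpos : ∀ k, 0 < n k → ∃ y ∈ s, c y = k := by
        intro k hk
        have : {x ∈ s | c x = k}.encard ≠ 0 := by
          intro h0
          have := hn k
          rw [h0, min_eq_left zero_le] at this
          have : n k = 0 := by exact_mod_cast this
          omega
        exact encard_ne_zero.1 this
      by_cases hx : ∃ a, e a = x
      · obtain ⟨a, rfl⟩ := hx
        obtain ⟨y, hy⟩ := hpos a.1 (Fin.pos a.2)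
        exact ⟨y, hy.1, by rw [hy.2]; exact (heinj.extend_apply _ _ _).symm⟩
      · obtain ⟨y, hy⟩ := hpos k₀ (by
          have := hn k₀
          rw [min_eq_right hk₀, Nat.cast_inj] at this
          omega)
        exact ⟨y, hy.1, by
          rw [hy.2]
          exact (Function.extend_apply' Sigma.fst (fun _ => k₀) x hx).symm⟩
    choose F hFs hF using hcol
    refine ⟨F, fun x _ => hFs x, fun k => ?_⟩
    simp only [hF]
    have himg : (e '' {a | a.1 = k}).encard = n k := by
      rw [heinj.encard_image]
      have : {a : Σ k, Fin (n k) | a.1 = k} = Sigma.mk k '' univ := by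
        ext ⟨k', i⟩
        constructor
        · rintro rfl
          exact ⟨i, mem_univ _, rfl⟩
        · rintro ⟨i, -, hi⟩
          exact (congrArg Sigma.fst hi).symm
      rw [this, sigma_mk_injective.encard_image, encard_univ, ENat.card_eq_coe_fintype_card,
        Fintype.card_fin]
    have hsub : e '' {a | a.1 = k} ⊆ {x ∈ s' | col x = k} := by
      rintro _ ⟨a, ha, rfl⟩
      exact ⟨hYs (he.mapsTo (mem_univ a)), (heinj.extend_apply _ _ _).trans ha⟩
    by_cases hk : k = k₀
    · subst hk
      rw [min_eq_right hk₀, min_eq_right]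
      refine le_trans ?_ (encard_le_encard hsub)
      rw [himg, hn, min_eq_right hk₀]
    · have : {x ∈ s' | col x = k} = e '' {a | a.1 = k} := by
        refine Subset.antisymm ?_ hsub
        rintro x ⟨-, hx⟩
        by_cases hx' : ∃ a, e a = x
        · obtain ⟨a, rfl⟩ := hx'
          exact ⟨a, (heinj.extend_apply _ _ _).symm.trans hx, rfl⟩
        · exact absurd ((Function.extend_apply' _ _ _ hx').symm.trans hx).symm hk
      rw [this, himg, hn, min_assoc, min_self]

end Trunc

/-! ### Counting types of nodes -/

/-- The counting types of level `j` over the colours `L`: the type of level `0` of a node is its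
colour, and the type of level `j + 1` consists of the colour and of the numbers of children of
each type of level `j`, counted up to the threshold `T j`. -/
def CountType (T : ℕ → ℕ) (L : Type) : ℕ → Type
  | 0 => L
  | j + 1 => L × (CountType T L j → Fin (T j + 1))

namespace CountType

/-- Counting types form a finite type. -/
noncomputable instance instFintype (T : ℕ → ℕ) (L : Type) [Fintype L] :
    (j : ℕ) → Fintype (CountType T L j)
  | 0 => inferInstanceAs (Fintype L)
  | j + 1 =>
    letI := instFintype T L j
    letI := Classical.decEq (CountType T L j)
    inferInstanceAs (Fintype (L × (CountType T L j → Fin (T j + 1))))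

lemma card_zero (T : ℕ → ℕ) (L : Type) [Fintype L] :
    Fintype.card (CountType T L 0) = Fintype.card L := rfl

lemma card_succ (T : ℕ → ℕ) (L : Type) [Fintype L] (j : ℕ) :
    Fintype.card (CountType T L (j + 1)) =
      Fintype.card L * (T j + 1) ^ Fintype.card (CountType T L j) := by
  classical
  rw [← Fintype.card_fin (T j + 1), ← Fintype.card_fun, ← Fintype.card_prod]
  exact Fintype.card_congr (Equiv.refl _)

end CountType

namespace LabeledTree

open Set

variable {p : ℕ} {t t' : LabeledTree.{u} p} {L : Type} {T T' : ℕ → ℕ}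

/-- The counting type of level `j` of a node, for the colouring `c`. -/
noncomputable def countType (t : LabeledTree.{u} p) (T : ℕ → ℕ) (c : t.V → L) :
    (j : ℕ) → t.V → CountType T L j
  | 0, v => c v
  | j + 1, v => (c v, fun τ => truncCard (T j) {w | t.IsChild w v ∧ t.countType T c j w = τ})

lemma countType_succ_eq_iff {c : t.V → L} {c' : t'.V → L} {j : ℕ} {v : t.V} {v' : t'.V} :
    t.countType T c (j + 1) v = t'.countType T c' (j + 1) v' ↔
      c v = c' v' ∧ ∀ τ, truncCard (T j) {w | t.IsChild w v ∧ t.countType T c j w = τ} =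
        truncCard (T j) {w | t'.IsChild w v' ∧ t'.countType T c' j w = τ} := by
  rw [countType, countType]
  constructor
  · intro h
    exact ⟨congrArg Prod.fst h, fun τ => congrFun (congrArg Prod.snd h) τ⟩
  · rintro ⟨h1, h2⟩
    exact Prod.ext h1 (funext h2)

lemma color_eq_of_countType_eq {c : t.V → L} {c' : t'.V → L} {j : ℕ} {v : t.V} {v' : t'.V}
    (h : t.countType T c j v = t'.countType T c' j v') : c v = c' v' := by
  cases j with
  | zero => exact h
  | succ j => exact (countType_succ_eq_iff.1 h).1

lemma exists_child_countType_eq {c : t.V → L} {c' : t'.V → L} {j : ℕ} {v : t.V} {v' : t'.V}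
    (hT : 1 ≤ T j) (h : t.countType T c (j + 1) v = t'.countType T c' (j + 1) v') {w : t.V}
    (hw : t.IsChild w v) :
    ∃ w', t'.IsChild w' v' ∧ t'.countType T c' j w' = t.countType T c j w := by
  have h1 := (countType_succ_eq_iff.1 h).2 (t.countType T c j w)
  rw [truncCard_eq_iff] at h1
  by_contra hcon
  have h2 : {w' | t'.IsChild w' v' ∧ t'.countType T c' j w' = t.countType T c j w} = ∅ := by
    ext w'
    simp only [mem_ofPred_eq, mem_empty_iff_false, iff_false]
    exact fun hw' => hcon ⟨w', hw'⟩
  rw [h2, encard_empty, min_eq_left zero_le] at h1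
  have h3 : {w' | t.IsChild w' v ∧ t.countType T c j w' = t.countType T c j w}.encard ≠ 0 :=
    encard_ne_zero.2 ⟨w, hw, rfl⟩
  rcases min_choice {w' | t.IsChild w' v ∧ t.countType T c j w' = t.countType T c j w}.encard
    (T j : ℕ∞) with h4 | h4
  · exact h3 (h4.symm.trans h1)
  · have : T j = 0 := by exact_mod_cast h4.symm.trans h1
    omega

lemma exists_two_children_countType_eq {c : t.V → L} {c' : t'.V → L} {j : ℕ} {v : t.V} {v' : t'.V}
    (hT : 2 ≤ T j) (h : t.countType T c (j + 1) v = t'.countType T c' (j + 1) v') {w₁ w₂ : t.V}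
    (hw₁ : t.IsChild w₁ v) (hw₂ : t.IsChild w₂ v) (hne : w₁ ≠ w₂) :
    ∃ w₁' w₂', t'.IsChild w₁' v' ∧ t'.IsChild w₂' v' ∧ w₁' ≠ w₂' ∧
      t'.countType T c' j w₁' = t.countType T c j w₁ ∧
      t'.countType T c' j w₂' = t.countType T c j w₂ := by
  by_cases he : t.countType T c j w₁ = t.countType T c j w₂
  · have h1 := (countType_succ_eq_iff.1 h).2 (t.countType T c j w₁)
    rw [truncCard_eq_iff] at h1
    have h2 : 1 < {w | t.IsChild w v ∧ t.countType T c j w = t.countType T c j w₁}.encard :=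
      one_lt_encard_iff.2 ⟨w₁, w₂, ⟨hw₁, rfl⟩, ⟨hw₂, he.symm⟩, hne⟩
    have h3 : 1 < min {w | t.IsChild w v ∧ t.countType T c j w = t.countType T c j w₁}.encard
        (T j : ℕ∞) := lt_min h2 (by exact_mod_cast hT)
    rw [h1] at h3
    obtain ⟨w₁', w₂', h4, h5, h6⟩ := one_lt_encard_iff.1 (h3.trans_le (min_le_left _ _))
    exact ⟨w₁', w₂', h4.1, h5.1, h6, h4.2, h5.2.trans he⟩
  · obtain ⟨w₁', h1, h2⟩ := exists_child_countType_eq (by omega) h hw₁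
    obtain ⟨w₂', h3, h4⟩ := exists_child_countType_eq (by omega) h hw₂
    refine ⟨w₁', w₂', h1, h3, ?_, h2, h4⟩
    rintro rfl
    exact he (h2.symm.trans h4)

/-- Nodes of one tree are matched, together with their parents, by nodes of any tree with the same
counting type. -/
lemma exists_node_countType_eq {c : t.V → L} {c' : t'.V → L} {d : ℕ} (hT : ∀ j, 1 ≤ T j)
    (h : t.countType T c d t.root = t'.countType T c' d t'.root) (n j : ℕ) (hnj : n + j = d)
    (x : t.V) (hx : t.depth x = n) :
    ∃ x' : t'.V, t'.depth x' = n ∧ t.countType T c j x = t'.countType T c' j x' ∧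
      ∀ y, t.IsChild x y → ∃ y', t'.IsChild x' y' ∧ c y = c' y' := by
  induction n generalizing j x with
  | zero =>
    obtain rfl := depth_eq_zero_iff.1 hx
    obtain rfl : j = d := by omega
    exact ⟨t'.root, depth_root, h, fun y hy => absurd rfl hy.ne_root⟩
  | succ n ih =>
    obtain ⟨h1, h2⟩ := isChild_parent_of_depth hx
    obtain ⟨y', h3, h4, -⟩ := ih (j + 1) (by omega) _ h2
    obtain ⟨x', h5, h6⟩ := exists_child_countType_eq (hT j) h4 h1
    refine ⟨x', by rw [h5.2, h3], h6.symm, fun y hy => ⟨y', h5, ?_⟩⟩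
    rw [hy.unique h1]
    exact color_eq_of_countType_eq h4

/-- With thresholds of at least two, pairs of distinct nodes of equal depth are matched by pairs of
distinct nodes. -/
lemma exists_two_nodes_countType_eq {c : t.V → L} {c' : t'.V → L} {d : ℕ} (hT : ∀ j, 2 ≤ T j)
    (h : t.countType T c d t.root = t'.countType T c' d t'.root) (n j : ℕ) (hnj : n + j = d)
    (x₁ x₂ : t.V) (hx₁ : t.depth x₁ = n) (hx₂ : t.depth x₂ = n) (hne : x₁ ≠ x₂) :
    ∃ x₁' x₂' : t'.V, x₁' ≠ x₂' ∧ t.countType T c j x₁ = t'.countType T c' j x₁' ∧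
      t.countType T c j x₂ = t'.countType T c' j x₂' := by
  have hT1 : ∀ j, 1 ≤ T j := fun j => by have := hT j; omega
  induction n generalizing j x₁ x₂ with
  | zero => exact absurd ((depth_eq_zero_iff.1 hx₁).trans (depth_eq_zero_iff.1 hx₂).symm) hne
  | succ n ih =>
    obtain ⟨h1, h2⟩ := isChild_parent_of_depth hx₁
    obtain ⟨h3, h4⟩ := isChild_parent_of_depth hx₂
    by_cases hp : t.parent x₁ = t.parent x₂
    · obtain ⟨y', -, h5, -⟩ := exists_node_countType_eq hT1 h n (j + 1) (by omega) _ h2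
      rw [← hp] at h3
      obtain ⟨x₁', x₂', -, -, h6, h7, h8⟩ := exists_two_children_countType_eq (hT j) h5 h1 h3 hne
      exact ⟨x₁', x₂', h6, h7.symm, h8.symm⟩
    · obtain ⟨y₁', y₂', h5, h6, h7⟩ := ih (j + 1) (by omega) _ _ h2 h4 hp
      obtain ⟨x₁', h8, h9⟩ := exists_child_countType_eq (hT1 j) h6 h1
      obtain ⟨x₂', h10, h11⟩ := exists_child_countType_eq (hT1 j) h7 h3
      refine ⟨x₁', x₂', ?_, h9.symm, h11.symm⟩
      rintro rfl
      exact h5 (h8.unique h10)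

lemma exists_color_eq {c : t.V → L} {c' : t'.V → L} {d : ℕ} (hT : ∀ j, 2 ≤ T j)
    (hd : t.height ≤ (d : ℕ∞))
    (h : t.countType T c d t.root = t'.countType T c' d t'.root) (x : t.V) :
    ∃ x', c' x' = c x ∧ ∀ y, t.IsChild x y → ∃ y', t'.IsChild x' y' ∧ c' y' = c y := by
  obtain ⟨x', -, h2, h3⟩ := exists_node_countType_eq
    (fun j => by have := hT j; omega) h _ (d - t.depth x)
    (by have := depth_le_of_height_le hd x; omega) x rfl
  refine ⟨x', (color_eq_of_countType_eq h2).symm, fun y hy => ?_⟩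
  obtain ⟨y', h4, h5⟩ := h3 y hy
  exact ⟨y', h4, h5.symm⟩

/-- With thresholds of at least two, the counting type determines whether a colour belongs to a
single node. -/
lemma eq_of_color_eq {c : t.V → L} {c' : t'.V → L} {d : ℕ} (hT : ∀ j, 2 ≤ T j)
    (hd : t.height ≤ (d : ℕ∞))
    (h : t.countType T c d t.root = t'.countType T c' d t'.root) {k : L}
    (hk : ∀ x' y', c' x' = k → c' y' = k → x' = y') (x y : t.V) (hx : c x = k) (hy : c y = k) :
    x = y := by
  have hT1 : ∀ j, 1 ≤ T j := fun j => by have := hT j; omega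
  have hdx := depth_le_of_height_le hd x
  have hdy := depth_le_of_height_le hd y
  by_contra hne
  by_cases hxy : t.depth y = t.depth x
  · obtain ⟨x', y', h1, h2, h3⟩ := exists_two_nodes_countType_eq hT h _ (d - t.depth x)
      (by omega) x y rfl hxy hne
    exact h1 (hk _ _ ((color_eq_of_countType_eq h2).symm.trans hx)
      ((color_eq_of_countType_eq h3).symm.trans hy))
  · obtain ⟨x', h1, h2, -⟩ := exists_node_countType_eq hT1 h _ (d - t.depth x) (by omega) x rfl
    obtain ⟨y', h3, h4, -⟩ := exists_node_countType_eq hT1 h _ (d - t.depth y) (by omega) y rfl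
    have := hk _ _ ((color_eq_of_countType_eq h2).symm.trans hx)
      ((color_eq_of_countType_eq h4).symm.trans hy)
    rw [← h3, ← h1, this] at hxy
    exact hxy rfl

/-! ### The answer to a set move -/

/-- The colouring `c`, refined by membership in the set `S`. -/
noncomputable def recolor {V : Type*} (c : V → L) (S : Set V) : V → L × Prop :=
  fun v => (c v, v ∈ S)

lemma recolor_eq_iff {V V' : Type*} {c : V → L} {c' : V' → L} {S : Set V} {S' : Set V'} {v : V}
    {v' : V'} : recolor c S v = recolor c' S' v' ↔ c v = c' v' ∧ (v ∈ S ↔ v' ∈ S') := by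
  rw [recolor, recolor, Prod.mk.injEq, eq_iff_iff]

variable [Fintype L]

/-- The local step of the answer to a set move: if two nodes have the same type for large
thresholds, the children of the second one can be sent to children of the first one with the same
type, so that all types for the small thresholds, in the refined colouring of the first tree, are
counted equally often. -/
lemma exists_map_children {c : t.V → L} {c' : t'.V → L} (S : Set t.V) {j : ℕ} (hT' : 1 ≤ T' j)
    (hT : T j = Fintype.card (CountType T' (L × Prop) j) * T' j) {v : t.V} {v' : t'.V}
    (h : t.countType T c (j + 1) v = t'.countType T c' (j + 1) v') :
    ∃ F : t'.V → t.V, (∀ w', t'.IsChild w' v' →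
        t.IsChild (F w') v ∧ t.countType T c j (F w') = t'.countType T c' j w') ∧
      ∀ σ, truncCard (T' j) {w | t.IsChild w v ∧ t.countType T' (recolor c S) j w = σ} =
        truncCard (T' j)
          {w' | t'.IsChild w' v' ∧ t.countType T' (recolor c S) j (F w') = σ} := by
  have : Nonempty t.V := ⟨t.root⟩
  have h1 := (countType_succ_eq_iff.1 h).2
  rw [hT] at h1
  choose F hF1 hF2 using fun τ => exists_map_truncCard_eq hT' (t.countType T' (recolor c S) j)
    {w | t.IsChild w v ∧ t.countType T c j w = τ}
    {w' | t'.IsChild w' v' ∧ t'.countType T c' j w' = τ} (h1 τ)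
  refine ⟨fun w' => F (t'.countType T c' j w') w', fun w' hw' => ?_, fun σ => ?_⟩
  · exact hF1 _ ⟨hw', rfl⟩
  · refine truncCard_eq_of_fibers (t.countType T c j) (t'.countType T c' j) fun τ => ?_
    have h2 := hF2 τ σ
    convert h2 using 2
    · ext w
      simp only [mem_ofPred_eq]
      tauto
    · ext w'
      simp only [mem_ofPred_eq]
      constructor
      · rintro ⟨⟨h3, h4⟩, rfl⟩
        exact ⟨⟨h3, rfl⟩, h4⟩
      · rintro ⟨⟨h3, rfl⟩, h4⟩
        exact ⟨⟨h3, h4⟩, rfl⟩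

/-- The back-and-forth property for sets: a set of nodes of the first tree is answered by its
preimage under a map of the second tree to the first one, which is built from the root downwards
by choosing the images of the children of each node. -/
lemma exists_set_countType_eq {c : t.V → L} {c' : t'.V → L} {d : ℕ} (hT' : ∀ j, 1 ≤ T' j)
    (hT : ∀ j, T j = Fintype.card (CountType T' (L × Prop) j) * T' j)
    (h : t.countType T c d t.root = t'.countType T c' d t'.root) (S : Set t.V) :
    ∃ S' : Set t'.V, t.countType T' (recolor c S) d t.root =
      t'.countType T' (recolor c' S') d t'.root := by
  have hloc : ∀ (j : ℕ) (v : t.V) (v' : t'.V), ∃ F : t'.V → t.V,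
      t.countType T c (j + 1) v = t'.countType T c' (j + 1) v' →
      (∀ w', t'.IsChild w' v' →
        t.IsChild (F w') v ∧ t.countType T c j (F w') = t'.countType T c' j w') ∧
      ∀ σ, truncCard (T' j) {w | t.IsChild w v ∧ t.countType T' (recolor c S) j w = σ} =
        truncCard (T' j)
          {w' | t'.IsChild w' v' ∧ t.countType T' (recolor c S) j (F w') = σ} := by
    intro j v v'
    by_cases hv : t.countType T c (j + 1) v = t'.countType T c' (j + 1) v'
    · obtain ⟨F, hF⟩ := exists_map_children S (hT' j) (hT j) hv
      exact ⟨F, fun _ => hF⟩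
    · exact ⟨fun _ => t.root, fun hv' => absurd hv' hv⟩
  choose F hF using hloc
  -- `Φ n` is the map on the nodes of depth `n`, and `φ` is the whole map.
  let Φ : ℕ → t'.V → t.V := fun n => Nat.rec (fun _ => t.root)
    (fun n Φ x => F (d - (n + 1)) (Φ (t'.parent x)) (t'.parent x) x) n
  let φ : t'.V → t.V := fun x => Φ (t'.depth x) x
  have hφ₀ : φ t'.root = t.root := by
    have : φ t'.root = Φ 0 t'.root := by rw [← depth_root]
    exact this
  have hφ : ∀ w v, t'.IsChild w v → φ w = F (d - t'.depth w) (φ v) v w := by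
    intro w v hwv
    have h1 : φ w = Φ (t'.depth v + 1) w := by rw [← hwv.2]
    have h2 : Φ (t'.depth v + 1) w =
      F (d - (t'.depth v + 1)) (Φ (t'.depth v) (t'.parent w)) (t'.parent w) w := rfl
    rw [h1, h2, hwv.parent_eq, hwv.2]
  have hty : ∀ n j, n + j = d → ∀ x, t'.depth x = n →
      t.countType T c j (φ x) = t'.countType T c' j x := by
    intro n
    induction n with
    | zero =>
      intro j hj x hx
      obtain rfl := depth_eq_zero_iff.1 hx
      obtain rfl : j = d := by omega
      rw [hφ₀, h]
    | succ n ih =>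
      intro j hj x hx
      obtain ⟨h1, h2⟩ := isChild_parent_of_depth hx
      have h3 := ih (j + 1) (by omega) _ h2
      rw [hφ _ _ h1, hx, show d - (n + 1) = j by omega]
      exact ((hF _ _ _ h3).1 x h1).2
  refine ⟨φ ⁻¹' S, ?_⟩
  have hcol : ∀ x, t'.depth x ≤ d → recolor c S (φ x) = recolor c' (φ ⁻¹' S) x := by
    intro x hx
    have := color_eq_of_countType_eq (hty _ (d - t'.depth x) (by omega) x rfl)
    rw [recolor, recolor, this]
    rfl
  have hmain : ∀ j n, n + j = d → ∀ x, t'.depth x = n →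
      t.countType T' (recolor c S) j (φ x) = t'.countType T' (recolor c' (φ ⁻¹' S)) j x := by
    intro j
    induction j with
    | zero =>
      intro n hn x hx
      exact hcol x (by omega)
    | succ j ih =>
      intro n hn x hx
      refine countType_succ_eq_iff.2 ⟨hcol x (by omega), fun σ => ?_⟩
      rw [(hF j _ _ (hty n (j + 1) hn x hx)).2 σ]
      congr 1
      ext w
      simp only [mem_ofPred_eq, and_congr_right_iff]
      intro hw
      have hdw : t'.depth w = n + 1 := by rw [hw.2, hx]
      rw [← ih (n + 1) (by omega) w hdw, hφ w x hw, hdw, show d - (n + 1) = j by omega]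
  have h0 := hmain d 0 (by omega) t'.root depth_root
  rwa [hφ₀] at h0

end LabeledTree

/-! ### Thresholds and numbers of counting types -/

/-- The thresholds for the type counts `N`, where `N m ℓ` is the number of types for the rank `m`
and `ℓ` colours: a set quantifier doubles the number of colours, and by the pigeonhole principle
the threshold for the rank `m + 1` has to be the number of types for the rank `m` times the
threshold for the rank `m`. -/
def threshold (N : ℕ → ℕ → ℕ) : ℕ → ℕ → ℕ
  | 0, _ => 2
  | m + 1, ℓ => N m (ℓ * 2) * threshold N m (ℓ * 2)

/-- `typeCount j m ℓ` is the number of counting types of level `j` over `ℓ` colours, with the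
thresholds `levelThreshold m ℓ` that suit the quantifier rank `m`. -/
def typeCount : ℕ → ℕ → ℕ → ℕ
  | 0, _, ℓ => ℓ
  | j + 1, m, ℓ => ℓ * (threshold (typeCount j) m ℓ + 1) ^ typeCount j m ℓ

/-- The thresholds for the quantifier rank `m` and `ℓ` colours, as a function of the level. -/
def levelThreshold (m ℓ : ℕ) (j : ℕ) : ℕ := threshold (typeCount j) m ℓ

lemma card_countType (m : ℕ) (L : Type) [Fintype L] (j : ℕ) :
    Fintype.card (CountType (levelThreshold m (Fintype.card L)) L j) =
      typeCount j m (Fintype.card L) := by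
  induction j with
  | zero => exact CountType.card_zero _ _
  | succ j ih => rw [CountType.card_succ, ih, typeCount, levelThreshold]

lemma typeCount_pos (j m : ℕ) {ℓ : ℕ} (hℓ : 1 ≤ ℓ) : 1 ≤ typeCount j m ℓ := by
  cases j with
  | zero => exact hℓ
  | succ j => exact Nat.mul_pos hℓ (pow_pos (Nat.succ_pos _) _)

lemma two_le_levelThreshold (m : ℕ) {ℓ : ℕ} (hℓ : 1 ≤ ℓ) (j : ℕ) : 2 ≤ levelThreshold m ℓ j := by
  rw [levelThreshold]
  induction m generalizing ℓ with
  | zero => exact le_rfl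
  | succ m ih =>
    rw [threshold]
    have h1 := typeCount_pos j m (ℓ := ℓ * 2) (by omega)
    have h2 := ih (ℓ := ℓ * 2) (by omega)
    nlinarith

/-! ### Counting types determine the monadic second-order theory -/

namespace LabeledTree

variable {p : ℕ}

/-- The colouring `c` records an assignment `a` of nodes and `A` of sets: it determines the labels
by `f`, the node `a i` is the only one of colour `e i`, and the set `A j` consists of the nodes
with a colour in `W j`. -/
structure Records {t : LabeledTree.{u} p} {L : Type} {n k : ℕ} (c : t.V → L) (f : L → Fin p)
    (e : Fin n → L) (W : Fin k → Set L) (a : Fin n → t.V) (A : Fin k → Set t.V) : Prop where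
  label : ∀ v, f (c v) = t.label v
  elem : ∀ i v, c v = e i ↔ v = a i
  set : ∀ j v, c v ∈ W j ↔ v ∈ A j

namespace Records

variable {t t' : LabeledTree.{u} p} {L : Type} {n k : ℕ} {c : t.V → L} {c' : t'.V → L}
  {f : L → Fin p} {e : Fin n → L} {W : Fin k → Set L} {a : Fin n → t.V} {A : Fin k → Set t.V}
  {a' : Fin n → t'.V} {A' : Fin k → Set t'.V} {T : ℕ → ℕ} {d : ℕ}

lemma color (h : Records c f e W a A) (i : Fin n) : c (a i) = e i := (h.elem i _).2 rfl

/-- The child relation between recorded nodes is determined by the counting type. -/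
lemma isChild (hT : ∀ j, 2 ≤ T j) (hd : t.height ≤ (d : ℕ∞))
    (h : t.countType T c d t.root = t'.countType T c' d t'.root)
    (hr : Records c f e W a A) (hr' : Records c' f e W a' A') {x y : Fin n}
    (hxy : t.IsChild (a x) (a y)) : t'.IsChild (a' x) (a' y) := by
  obtain ⟨x', h1, h2⟩ := exists_color_eq hT hd h (a x)
  obtain ⟨y', h3, h4⟩ := h2 _ hxy
  rw [hr.color] at h1 h4
  rwa [(hr'.elem _ _).1 h1, (hr'.elem _ _).1 h4] at h3

lemma adj (hT : ∀ j, 2 ≤ T j) (hd : t.height ≤ (d : ℕ∞))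
    (h : t.countType T c d t.root = t'.countType T c' d t'.root)
    (hr : Records c f e W a A) (hr' : Records c' f e W a' A') {x y : Fin n}
    (hxy : t.graph.Adj (a x) (a y)) : t'.graph.Adj (a' x) (a' y) := by
  rw [adj_iff_isChild] at hxy ⊢
  exact hxy.imp (hr.isChild hT hd h hr') (hr.isChild hT hd h hr')

lemma eq_root (hr : Records c f e W a A) (hr' : Records c' f e W a' A')
    (h : t.countType T c d t.root = t'.countType T c' d t'.root) {x : Fin n}
    (hx : a x = t.root) : a' x = t'.root := by
  have := color_eq_of_countType_eq h
  rw [← hx, hr.color] at this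
  exact ((hr'.elem _ _).1 this.symm).symm

lemma eq_elem (hr : Records c f e W a A) (hr' : Records c' f e W a' A') {x y : Fin n}
    (hxy : a x = a y) : a' x = a' y := by
  rw [← hr'.elem, hr'.color, ← hr.color, hxy, hr.color]

/-- After refining by a set, the recorded nodes still have recorded colours. -/
lemma recolor (hr : Records c f e W a A) (S : Set t.V) :
    Records (recolor c S) (f ∘ Prod.fst) (fun i => (e i, a i ∈ S))
      (fun j => {q | q.1 ∈ W j}) a A where
  label v := hr.label v
  elem i v := by
    constructor
    · intro h
      exact (hr.elem i v).1 (congrArg Prod.fst h)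
    · rintro rfl
      exact Prod.ext (hr.color i) rfl
  set j v := hr.set j v

/-- Refinements with the same counting type give the recorded nodes the same colours. -/
lemma mem_iff_mem (hT : ∀ j, 2 ≤ T j) (hd : t.height ≤ (d : ℕ∞))
    (hr : Records c f e W a A) (hr' : Records c' f e W a' A') {S : Set t.V} {S' : Set t'.V}
    (h : t.countType T (LabeledTree.recolor c S) d t.root =
      t'.countType T (LabeledTree.recolor c' S') d t'.root) (i : Fin n) :
    a i ∈ S ↔ a' i ∈ S' := by
  obtain ⟨x', h1, -⟩ := exists_color_eq hT hd h (a i)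
  have h2 : c' x' = c (a i) := congrArg Prod.fst h1
  rw [hr.color, hr'.elem] at h2
  rw [h2] at h1
  exact (recolor_eq_iff.1 h1).2.symm

lemma cons_set (S : Set t.V) {f : L × Prop → Fin p} {e : Fin n → L × Prop}
    {W : Fin k → Set (L × Prop)} (hr : Records (LabeledTree.recolor c S) f e W a A) :
    Records (LabeledTree.recolor c S) f e (Fin.cons {q | q.2} W : Fin (k + 1) → Set (L × Prop)) a
      (Fin.cons S A : Fin (k + 1) → Set t.V) where
  label := hr.label
  elem := hr.elem
  set j v := by
    induction j using Fin.cases with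
    | zero => exact Iff.rfl
    | succ j => exact hr.set j v

lemma cons_elem {c : t.V → L} (hr : Records c f e W a A) {q : L} {v : t.V}
    (hq : ∀ w, c w = q ↔ w = v) :
    Records c f (Fin.cons q e : Fin (n + 1) → L) W (Fin.cons v a : Fin (n + 1) → t.V) A where
  label := hr.label
  elem i w := by
    induction i using Fin.cases with
    | zero => exact hq w
    | succ i => exact hr.elem i w
  set := hr.set

end Records

open MSOFormula in
/-- The counting types for the rank `m` determine which formulas of rank at most `m` hold. -/
theorem sat_iff_of_countType_eq {d n k : ℕ} (φ : MSOFormula p n k) :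
    ∀ {m : ℕ} {L : Type} [Fintype L] {t t' : LabeledTree.{u} p} {c : t.V → L} {c' : t'.V → L}
      {f : L → Fin p} {e : Fin n → L} {W : Fin k → Set L} {a : Fin n → t.V} {A : Fin k → Set t.V}
      {a' : Fin n → t'.V} {A' : Fin k → Set t'.V}, φ.rank ≤ m →
      t.height ≤ (d : ℕ∞) → t'.height ≤ (d : ℕ∞) →
      Records c f e W a A → Records c' f e W a' A' →
      t.countType (levelThreshold m (Fintype.card L)) c d t.root =
        t'.countType (levelThreshold m (Fintype.card L)) c' d t'.root →
      (φ.Sat t a A ↔ φ.Sat t' a' A') := by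
  have hT : ∀ {L : Type} [Fintype L] {t : LabeledTree.{u} p} (_ : t.V → L) (m j : ℕ),
      2 ≤ levelThreshold m (Fintype.card L) j := fun {L} _ {t} c m j =>
    two_le_levelThreshold m (Fintype.card_pos_iff.2 ⟨c t.root⟩) j
  -- The answer to a set move, with the thresholds of the next lower rank.
  have hset : ∀ {m : ℕ} {L : Type} [Fintype L] {t t' : LabeledTree.{u} p} {c : t.V → L}
      {c' : t'.V → L}, t.countType (levelThreshold (m + 1) (Fintype.card L)) c d t.root =
        t'.countType (levelThreshold (m + 1) (Fintype.card L)) c' d t'.root → ∀ S : Set t.V,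
      ∃ S' : Set t'.V,
        t.countType (levelThreshold m (Fintype.card (L × Prop))) (recolor c S) d t.root =
        t'.countType (levelThreshold m (Fintype.card (L × Prop))) (recolor c' S') d t'.root := by
    intro m L _ t t' c c' h S
    refine exists_set_countType_eq (fun j => ?_) (fun j => ?_) h S
    · have := hT (recolor c S) m j
      omega
    · rw [card_countType, Fintype.card_prod, Fintype.card_prop]
      rfl
  induction φ with
  | falsum => intros; exact Iff.rfl
  | eq x y =>
    intro m L _ t t' c c' f e W a A a' A' _ _ _ hr hr' _
    exact ⟨fun h => hr.eq_elem hr' h, fun h => hr'.eq_elem hr h⟩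
  | edge x y =>
    intro m L _ t t' c c' f e W a A a' A' _ hd hd' hr hr' h
    exact ⟨fun hxy => hr.adj (hT c m) hd h hr' hxy,
      fun hxy => hr'.adj (hT c m) hd' h.symm hr hxy⟩
  | root x =>
    intro m L _ t t' c c' f e W a A a' A' _ _ _ hr hr' h
    exact ⟨fun hx => hr.eq_root hr' h hx, fun hx => hr'.eq_root hr h.symm hx⟩
  | label i x =>
    intro m L _ t t' c c' f e W a A a' A' _ _ _ hr hr' _
    rw [Sat, Sat, ← hr.label, ← hr'.label, hr.color, hr'.color]
  | mem x X =>
    intro m L _ t t' c c' f e W a A a' A' _ _ _ hr hr' _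
    rw [Sat, Sat, ← hr.set, ← hr'.set, hr.color, hr'.color]
  | neg φ ih =>
    intro m L _ t t' c c' f e W a A a' A' hm hd hd' hr hr' h
    exact not_congr (ih hm hd hd' hr hr' h)
  | and φ ψ ih₁ ih₂ =>
    intro m L _ t t' c c' f e W a A a' A' hm hd hd' hr hr' h
    exact and_congr (ih₁ ((le_max_left _ _).trans hm) hd hd' hr hr' h)
      (ih₂ ((le_max_right _ _).trans hm) hd hd' hr hr' h)
  | exElem φ ih =>
    have key : ∀ {m : ℕ} {L : Type} [Fintype L] {t t' : LabeledTree.{u} p} {c : t.V → L}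
        {c' : t'.V → L} {f : L → Fin p} {e W a A a' A'}, φ.rank ≤ m →
        t.height ≤ (d : ℕ∞) → t'.height ≤ (d : ℕ∞) →
        Records c f e W a A → Records c' f e W a' A' →
        t.countType (levelThreshold (m + 1) (Fintype.card L)) c d t.root =
          t'.countType (levelThreshold (m + 1) (Fintype.card L)) c' d t'.root →
        φ.exElem.Sat t a A → φ.exElem.Sat t' a' A' := by
      rintro m L _ t t' c c' f e W a A a' A' hm hd hd' hr hr' h ⟨v, hv⟩
      -- The set that answers the singleton of `v` is a singleton, too.
      obtain ⟨S', hS'⟩ := hset h {v}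
      have hT2 := hT (recolor c {v}) m
      obtain ⟨v', hv', -⟩ := exists_color_eq hT2 hd hS' v
      have hS'v : ∀ w', w' ∈ S' → w' = v' := by
        intro w' hw'
        obtain ⟨w, hw, -⟩ := exists_color_eq hT2 hd' hS'.symm w'
        have h1 : w = v := (recolor_eq_iff.1 hw).2.2 hw'
        subst h1
        refine eq_of_color_eq hT2 hd' hS'.symm (k := recolor c {w} w) ?_ _ _ hw.symm hv'
        intro x y hx hy
        have hx' : x = w := (recolor_eq_iff.1 hx).2.2 rfl
        have hy' : y = w := (recolor_eq_iff.1 hy).2.2 rfl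
        rw [hx', hy']
      have hmem : v' ∈ S' := (recolor_eq_iff.1 hv').2.2 rfl
      have hrec' := hr'.recolor S'
      simp only [← hr.mem_iff_mem hT2 hd hr' hS'] at hrec'
      refine ⟨v', (ih hm hd hd' ((hr.recolor {v}).cons_elem (q := recolor c {v} v) (v := v) ?_)
        (hrec'.cons_elem (q := recolor c {v} v) (v := v') ?_) hS').1 hv⟩
      · intro w
        constructor
        · intro hw
          exact (recolor_eq_iff.1 hw).2.2 rfl
        · rintro rfl
          rfl
      · intro w'
        rw [← hv']
        constructor
        · intro hw'
          exact hS'v w' ((recolor_eq_iff.1 hw').2.2 hmem)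
        · rintro rfl
          rfl
    intro m L _ t t' c c' f e W a A a' A' hm hd hd' hr hr' h
    obtain ⟨m, rfl⟩ : ∃ m', m = m' + 1 := ⟨m - 1, by rw [rank] at hm; omega⟩
    have hm : φ.rank ≤ m := by rw [rank] at hm; omega
    exact ⟨key hm hd hd' hr hr' h, key hm hd' hd hr' hr h.symm⟩
  | exSet φ ih =>
    have key : ∀ {m : ℕ} {L : Type} [Fintype L] {t t' : LabeledTree.{u} p} {c : t.V → L}
        {c' : t'.V → L} {f : L → Fin p} {e W a A a' A'}, φ.rank ≤ m →
        t.height ≤ (d : ℕ∞) → t'.height ≤ (d : ℕ∞) →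
        Records c f e W a A → Records c' f e W a' A' →
        t.countType (levelThreshold (m + 1) (Fintype.card L)) c d t.root =
          t'.countType (levelThreshold (m + 1) (Fintype.card L)) c' d t'.root →
        φ.exSet.Sat t a A → φ.exSet.Sat t' a' A' := by
      rintro m L _ t t' c c' f e W a A a' A' hm hd hd' hr hr' h ⟨S, hS⟩
      obtain ⟨S', hS'⟩ := hset h S
      have hrec' := hr'.recolor S'
      simp only [← hr.mem_iff_mem (hT (recolor c S) m) hd hr' hS'] at hrec'
      exact ⟨S', (ih hm hd hd' ((hr.recolor S).cons_set S)
        (hrec'.cons_set S') hS').1 hS⟩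
    intro m L _ t t' c c' f e W a A a' A' hm hd hd' hr hr' h
    obtain ⟨m, rfl⟩ : ∃ m', m = m' + 1 := ⟨m - 1, by rw [rank] at hm; omega⟩
    have hm : φ.rank ≤ m := by rw [rank] at hm; omega
    exact ⟨key hm hd hd' hr hr' h, key hm hd' hd hr' hr h.symm⟩

/-- Trees with the same counting type, for the colouring by the labels, satisfy the same sentences
of rank at most `m`. -/
theorem msoEquiv_of_countType_eq {m d : ℕ} {t t' : LabeledTree.{u} p} (hd : t.height ≤ (d : ℕ∞))
    (hd' : t'.height ≤ (d : ℕ∞))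
    (h : t.countType (levelThreshold m p) t.label d t.root =
      t'.countType (levelThreshold m p) t'.label d t'.root) : MSOEquiv m t t' := by
  intro φ hφ
  refine sat_iff_of_countType_eq φ (L := Fin p) (c := t.label) (c' := t'.label) (f := id)
    (e := Fin.elim0) (W := Fin.elim0) hφ hd hd' ?_ ?_ ?_
  · exact ⟨fun _ => rfl, fun i => i.elim0, fun j => j.elim0⟩
  · exact ⟨fun _ => rfl, fun i => i.elim0, fun j => j.elim0⟩
  · rwa [Fintype.card_fin]

end LabeledTree

/-! ### Small leaf-hereditary subtrees -/

section Trunc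

open Set

/-- A set has a small subset with the same truncated numbers of elements of each colour. -/
lemma exists_subset_truncCard_eq {V ι : Type*} [Fintype ι] (T : ℕ) (s : Set V) (f : V → ι) :
    ∃ r ⊆ s, r.encard ≤ ((Fintype.card ι * T : ℕ) : ℕ∞) ∧
      ∀ i, truncCard T {x ∈ r | f x = i} = truncCard T {x ∈ s | f x = i} := by
  choose r hr hcard using fun i =>
    exists_subset_encard_eq (min_le_left {x ∈ s | f x = i}.encard (T : ℕ∞))
  have hfib : ∀ i, {x ∈ ⋃ i, r i | f x = i} = r i := by
    intro i
    ext x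
    simp only [mem_iUnion, mem_ofPred_eq]
    constructor
    · rintro ⟨⟨i', hx⟩, rfl⟩
      obtain rfl : i' = f x := (hr i' hx).2.symm
      exact hx
    · intro hx
      exact ⟨⟨i, hx⟩, (hr i hx).2⟩
  refine ⟨⋃ i, r i, iUnion_subset fun i => (hr i).trans (sep_subset _ _), ?_, fun i => ?_⟩
  · refine (encard_iUnion_le_of_fintype r).trans ?_
    calc ∑ i, (r i).encard ≤ ∑ _i : ι, (T : ℕ∞) :=
          Finset.sum_le_sum fun i _ => (hcard i).trans_le (min_le_right _ _)
      _ = ((Fintype.card ι * T : ℕ) : ℕ∞) := by simp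
  · rw [hfib, truncCard_eq_iff, hcard, min_assoc, min_self]

end Trunc

namespace LabeledTree

open Set

variable {p : ℕ} {t : LabeledTree.{u} p}

namespace Subtree

/-- The inclusion of the nodes of a subtree. -/
def incl (s : t.Subtree) (v : s.toTree.V) : t.V := Subtype.val (p := (· ∈ s.nodes)) v

lemma incl_injective (s : t.Subtree) : Function.Injective s.incl :=
  Subtype.val_injective (p := (· ∈ s.nodes))

lemma incl_mem (s : t.Subtree) (v : s.toTree.V) : s.incl v ∈ s.nodes :=
  Subtype.property (p := (· ∈ s.nodes)) v

lemma exists_incl_eq (s : t.Subtree) {v : t.V} (hv : v ∈ s.nodes) : ∃ v', s.incl v' = v :=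
  ⟨(⟨v, hv⟩ : s.nodes), rfl⟩

lemma incl_root (s : t.Subtree) : s.incl s.toTree.root = t.root := rfl

/-- The inclusion as an embedding of graphs. -/
def inclEmbedding (s : t.Subtree) : s.toTree.graph ↪g t.graph :=
  SimpleGraph.Embedding.induce s.nodes

/-- A path of the subtree is a path of the tree, and those are unique; so the depths agree. -/
lemma depth_incl (s : t.Subtree) (v : s.toTree.V) : t.depth (s.incl v) = s.toTree.depth v := by
  obtain ⟨q, hq, hlen⟩ := s.toTree.isTree.connected.exists_path_of_dist s.toTree.root v
  obtain ⟨q', hq', hlen'⟩ := t.isTree.connected.exists_path_of_dist t.root (s.incl v)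
  have h1 : (q.map s.inclEmbedding.toHom).IsPath :=
    SimpleGraph.Walk.IsPath.map s.incl_injective hq
  have h2 := (t.isTree.existsUnique_path t.root (s.incl v)).unique h1 hq'
  have h3 := SimpleGraph.Walk.length_map s.inclEmbedding.toHom q
  refine hlen'.symm.trans (Eq.trans ?_ hlen)
  rw [← h2]
  exact h3

lemma isChild_incl_iff (s : t.Subtree) {w v : s.toTree.V} :
    t.IsChild (s.incl w) (s.incl v) ↔ s.toTree.IsChild w v := by
  rw [IsChild, IsChild, depth_incl, depth_incl]
  exact and_congr_left fun _ => s.inclEmbedding.map_adj_iff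

end Subtree

/-- The nodes that are reached from the root when at each node `v` only the children in `K v` are
selected. -/
inductive Selected (t : LabeledTree.{u} p) (K : t.V → Set t.V) : t.V → Prop
  | root : Selected t K t.root
  | child {v w : t.V} (hv : Selected t K v) (hw : w ∈ K v) (h : t.IsChild w v) : Selected t K w

lemma Selected.mem {K : t.V → Set t.V} {v w : t.V} (hw : t.Selected K w) (h : t.IsChild w v) :
    w ∈ K v ∧ t.Selected K v := by
  cases hw with
  | root => exact absurd rfl h.ne_root
  | child hv hw h' =>
    rw [h.unique h']
    exact ⟨hw, hv⟩

/-- The subtree of the selected nodes. -/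
def selectedSubtree (t : LabeledTree.{u} p) (K : t.V → Set t.V) : t.Subtree where
  nodes := {v | t.Selected K v}
  root_mem := Selected.root
  connected := by
    have h : ∀ v (hv : t.Selected K v), (t.graph.induce {v | t.Selected K v}).Reachable
        ⟨t.root, Selected.root⟩ ⟨v, hv⟩ := by
      intro v hv
      induction hv with
      | root => exact SimpleGraph.Reachable.refl _
      | @child v w hv hw h ih =>
        refine ih.trans (SimpleGraph.Adj.reachable ?_)
        exact h.1
    have : Nonempty {v | t.Selected K v} := ⟨⟨t.root, Selected.root⟩⟩
    exact ⟨fun v w => (h v.1 v.2).symm.trans (h w.1 w.2)⟩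

variable {L : Type} {T : ℕ → ℕ} {d : ℕ}

/-- If at each node enough children of each type are selected, the selected subtree has the same
counting types. -/
lemma countType_selectedSubtree {c : t.V → L} {K : t.V → Set t.V}
    (hK : ∀ v, K v ⊆ {w | t.IsChild w v})
    (hcount : ∀ j v, t.depth v + (j + 1) = d → ∀ τ,
      truncCard (T j) {w ∈ K v | t.countType T c j w = τ} =
        truncCard (T j) {w ∈ {w | t.IsChild w v} | t.countType T c j w = τ})
    {s : t.Subtree} (hs : ∀ v, v ∈ s.nodes ↔ t.Selected K v) (j : ℕ) (v : s.toTree.V)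
    (hv : t.depth (s.incl v) + j = d) :
    s.toTree.countType T (fun w => c (s.incl w)) j v = t.countType T c j (s.incl v) := by
  have hmem : ∀ v, t.Selected K (s.incl v) := fun v => (hs _).1 (s.incl_mem v)
  induction j generalizing v with
  | zero => rfl
  | succ j ih =>
    refine countType_succ_eq_iff.2 ⟨rfl, fun τ => ?_⟩
    refine Eq.trans ?_ (hcount j (s.incl v) hv τ)
    rw [truncCard_eq_iff, ← s.incl_injective.encard_image]
    congr 2
    ext w
    constructor
    · rintro ⟨w, ⟨h1, h2⟩, rfl⟩
      have h3 := s.isChild_incl_iff.2 h1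
      rw [ih w (by rw [h3.2]; omega)] at h2
      exact ⟨((hmem w).mem h3).1, h2⟩
    · rintro ⟨h1, h2⟩
      have h3 : t.IsChild w (s.incl v) := hK _ h1
      obtain ⟨w, rfl⟩ := s.exists_incl_eq ((hs w).2 (Selected.child (hmem v) h1 h3))
      refine ⟨w, ⟨s.isChild_incl_iff.1 h3, ?_⟩, rfl⟩
      rw [ih _ (by rw [h3.2]; omega)]
      exact h2

/-- If at most `B` children are selected at each node, each level of depth multiplies the number of
selected nodes by at most `B + 1`. -/
lemma encard_selected_le {K : t.V → Set t.V} {B : ℕ} (n : ℕ)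
    (hB : n ≠ 0 → ∀ v, (K v).encard ≤ B) :
    {v | t.Selected K v ∧ t.depth v ≤ n}.encard ≤ (((B + 1) ^ n : ℕ) : ℕ∞) := by
  induction n with
  | zero =>
    rw [pow_zero, Nat.cast_one, encard_le_one_iff]
    rintro a b ⟨-, ha⟩ ⟨-, hb⟩
    rw [depth_eq_zero_iff.1 (Nat.le_zero.1 ha), depth_eq_zero_iff.1 (Nat.le_zero.1 hb)]
  | succ n ih =>
    have hB := hB (Nat.succ_ne_zero n)
    have ih := ih fun _ => hB
    set A := {v | t.Selected K v ∧ t.depth v ≤ n} with hA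
    have hfin : A.Finite := encard_lt_top_iff.1 (ih.trans_lt (ENat.natCast_lt_top _))
    have hsub : {v | t.Selected K v ∧ t.depth v ≤ n + 1} ⊆ A ∪ ⋃ v ∈ hfin.toFinset, K v := by
      rintro w ⟨hw, hd⟩
      by_cases h0 : w = t.root
      · refine Or.inl ⟨hw, ?_⟩
        rw [h0, depth_root]
        exact Nat.zero_le _
      · have h1 := isChild_parent h0
        have h2 := hw.mem h1
        refine Or.inr (mem_iUnion₂.2 ⟨t.parent w, hfin.mem_toFinset.2 ⟨h2.2, ?_⟩, h2.1⟩)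
        have := h1.2
        omega
    refine (encard_le_encard hsub).trans ((encard_union_le _ _).trans ?_)
    have h1 : (⋃ v ∈ hfin.toFinset, K v).encard ≤ A.encard * B := by
      refine (Finset.set_encard_biUnion_le _ _).trans ((Finset.sum_le_sum fun v _ => hB v).trans ?_)
      rw [Finset.sum_const, nsmul_eq_mul, hfin.encard_eq_coe_toFinset_card]
    calc A.encard + (⋃ v ∈ hfin.toFinset, K v).encard ≤ A.encard + A.encard * B := by gcongr
      _ = A.encard * (B + 1) := by ring
      _ ≤ (((B + 1) ^ n : ℕ) : ℕ∞) * (B + 1) := by gcongr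
      _ = (((B + 1) ^ (n + 1) : ℕ) : ℕ∞) := by push_cast; ring

/-- A tree of height at most `d` has a small leaf-hereditary subtree of the same height and the same
counting type. -/
theorem exists_subtree_countType_eq [Fintype L] (hT : ∀ j, 1 ≤ T j) (c : t.V → L)
    (hd : t.height ≤ (d : ℕ∞)) {B : ℕ}
    (hB : ∀ j < d, Fintype.card (CountType T L j) * T j ≤ B) :
    ∃ s : t.Subtree, s.IsLeafHereditary ∧ s.toTree.height = t.height ∧ s.nodes.Finite ∧
      s.nodes.ncard ≤ (B + 1) ^ d ∧
      s.toTree.countType T (fun w => c (s.incl w)) d s.toTree.root = t.countType T c d t.root := by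
  choose K hK hcard hcount using fun v =>
    exists_subset_truncCard_eq (T (d - 1 - t.depth v)) {w | t.IsChild w v}
      (t.countType T c (d - 1 - t.depth v))
  have hcount' : ∀ j v, t.depth v + (j + 1) = d → ∀ τ,
      truncCard (T j) {w ∈ K v | t.countType T c j w = τ} =
        truncCard (T j) {w ∈ {w | t.IsChild w v} | t.countType T c j w = τ} := by
    intro j v hj
    obtain rfl : d - 1 - t.depth v = j := by omega
    exact hcount v
  have hty := countType_selectedSubtree hK hcount' (s := t.selectedSubtree K) fun _ => Iff.rfl
  have hroot := hty d (t.selectedSubtree K).toTree.root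
    (by rw [Subtree.incl_root, depth_root, zero_add])
  have hnodes : (t.selectedSubtree K).nodes = {v | t.Selected K v ∧ t.depth v ≤ d} := by
    ext v
    exact ⟨fun hv => ⟨hv, depth_le_of_height_le hd v⟩, fun hv => hv.1⟩
  have hle : (t.selectedSubtree K).nodes.encard ≤ (((B + 1) ^ d : ℕ) : ℕ∞) := by
    rw [hnodes]
    refine encard_selected_le d fun h0 v => (hcard v).trans ?_
    exact_mod_cast hB _ (by omega)
  refine ⟨t.selectedSubtree K, ?_, ?_, ?_, ?_, hroot⟩
  · intro v hv w hw
    have h1 := depth_le_of_height_le hd w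
    rw [hw.2] at h1
    have h2 := hty (d - 1 - t.depth v.1 + 1) v
      (by change t.depth v.1 + _ = d; omega)
    obtain ⟨w', hw', -⟩ := exists_child_countType_eq (hT _) h2.symm hw
    exact hv w' hw'
  · refine le_antisymm (iSup_le fun v => ?_) (iSup_le fun v => ?_)
    · rw [← Subtree.depth_incl]
      exact le_iSup (fun v => (t.depth v : ℕ∞)) _
    · obtain ⟨v', hv', -⟩ := exists_node_countType_eq hT hroot.symm _ (d - t.depth v)
        (by have := depth_le_of_height_le hd v; omega) v rfl
      rw [← hv']
      exact le_iSup (fun v => ((t.selectedSubtree K).toTree.depth v : ℕ∞)) v'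
  · exact encard_lt_top_iff.1 (hle.trans_lt (ENat.natCast_lt_top _))
  · rw [ncard_def]
    exact (ENat.toNat_le_toNat hle (ENat.natCast_ne_top _)).trans (ENat.toNat_natCast _).le

end LabeledTree

/-! ### Tower bounds -/

lemma tower_mono (d : ℕ) {x y : ℝ} (h : x ≤ y) : tower d x ≤ tower d y := by
  induction d with
  | zero => exact h
  | succ d ih => exact Real.rpow_le_rpow_of_exponent_le one_le_two ih

lemma add_one_le_two_rpow {x : ℝ} (hx : 1 ≤ x) : x + 1 ≤ (2 : ℝ) ^ x := by
  have := one_add_mul_self_le_rpow_one_add (s := 1) (by norm_num) hx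
  norm_num at this
  linarith

lemma le_tower (d : ℕ) {x : ℝ} (hx : 1 ≤ x) : x ≤ tower d x := by
  induction d with
  | zero => exact le_rfl
  | succ d ih =>
    have := add_one_le_two_rpow (hx.trans ih)
    rw [tower]
    linarith

lemma tower_le_tower_of_le {d e : ℕ} (h : d ≤ e) {x : ℝ} (hx : 1 ≤ x) : tower d x ≤ tower e x := by
  induction e, h using Nat.le_induction with
  | base => exact le_rfl
  | succ e _ ih =>
    have := add_one_le_two_rpow (hx.trans (le_tower e hx))
    rw [tower]
    linarith

/-- Constant factors can be moved into a tower. -/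
lemma natCast_mul_tower_le (d : ℕ) {c : ℕ} (hc : 1 ≤ c) {x : ℝ} (hx : 1 ≤ x) :
    (c : ℝ) * tower d x ≤ tower d (c * x) := by
  induction d with
  | zero => exact le_rfl
  | succ d ih =>
    rw [tower, tower]
    refine le_trans ?_ (Real.rpow_le_rpow_of_exponent_le one_le_two ih)
    obtain ⟨b, rfl⟩ : ∃ b, c = b + 1 := ⟨c - 1, by omega⟩
    have h1 : ((b + 1 : ℕ) : ℝ) ≤ (2 : ℝ) ^ (b : ℝ) := by
      rw [Real.rpow_natCast]
      exact_mod_cast Nat.lt_two_pow_self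
    have h2 : (2 : ℝ) ^ (b : ℝ) ≤ (2 : ℝ) ^ (b * tower d x) := by
      refine Real.rpow_le_rpow_of_exponent_le one_le_two ?_
      exact le_mul_of_one_le_right (Nat.cast_nonneg b) (hx.trans (le_tower d hx))
    calc ((b + 1 : ℕ) : ℝ) * 2 ^ tower d x ≤ 2 ^ (b * tower d x) * 2 ^ tower d x := by
          gcongr
          exact h1.trans h2
      _ = 2 ^ (((b + 1 : ℕ) : ℝ) * tower d x) := by
          rw [← Real.rpow_add two_pos]
          push_cast
          ring_nf

/-- The argument of the towers that bound the numbers of types for the rank `m` and `ℓ` colours. -/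
noncomputable def towerArg (m ℓ : ℕ) : ℝ := ((m : ℝ) + 1) * ((m : ℝ) + 1 + Real.logb 2 ℓ)

lemma logb_two_natCast_nonneg {ℓ : ℕ} (hℓ : 1 ≤ ℓ) : 0 ≤ Real.logb 2 (ℓ : ℝ) :=
  Real.logb_nonneg one_lt_two (by exact_mod_cast hℓ)

lemma add_one_le_towerArg (m : ℕ) {ℓ : ℕ} (hℓ : 1 ≤ ℓ) : (m : ℝ) + 1 ≤ towerArg m ℓ := by
  have := logb_two_natCast_nonneg hℓ
  have hm : (0 : ℝ) ≤ m := Nat.cast_nonneg m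
  rw [towerArg]
  nlinarith

lemma one_le_towerArg (m : ℕ) {ℓ : ℕ} (hℓ : 1 ≤ ℓ) : 1 ≤ towerArg m ℓ := by
  have := add_one_le_towerArg m hℓ
  have hm : (0 : ℝ) ≤ m := Nat.cast_nonneg m
  linarith

lemma logb_two_mul_two {ℓ : ℕ} (hℓ : 1 ≤ ℓ) :
    Real.logb 2 ((ℓ * 2 : ℕ) : ℝ) = Real.logb 2 ℓ + 1 := by
  have hℓ' : (ℓ : ℝ) ≠ 0 := by positivity
  push_cast
  rw [Real.logb_mul hℓ' two_ne_zero, Real.logb_self_eq_one one_lt_two]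

/-- Trading one unit of the rank for a doubling of the number of colours does not increase the
argument of the towers. -/
lemma towerArg_mul_two_le (m : ℕ) {ℓ : ℕ} (hℓ : 1 ≤ ℓ) :
    towerArg m (ℓ * 2) ≤ towerArg (m + 1) ℓ := by
  have := logb_two_natCast_nonneg hℓ
  have hm : (0 : ℝ) ≤ m := Nat.cast_nonneg m
  rw [towerArg, towerArg, logb_two_mul_two hℓ]
  push_cast
  nlinarith

lemma natCast_eq_two_rpow {ℓ : ℕ} (hℓ : 1 ≤ ℓ) : (ℓ : ℝ) = 2 ^ Real.logb 2 (ℓ : ℝ) := by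
  have : (0 : ℝ) < ℓ := by exact_mod_cast hℓ
  rw [Real.rpow_logb two_pos (by norm_num) this]

lemma logb_le_towerArg (m : ℕ) {ℓ : ℕ} (hℓ : 1 ≤ ℓ) : Real.logb 2 (ℓ : ℝ) ≤ towerArg m ℓ := by
  have := logb_two_natCast_nonneg hℓ
  have hm : (0 : ℝ) ≤ m := Nat.cast_nonneg m
  rw [towerArg]
  nlinarith

lemma natCast_le_two_rpow_towerArg (m : ℕ) {ℓ : ℕ} (hℓ : 1 ≤ ℓ) : (ℓ : ℝ) ≤ 2 ^ towerArg m ℓ := by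
  conv_lhs => rw [natCast_eq_two_rpow hℓ]
  exact Real.rpow_le_rpow_of_exponent_le one_le_two (logb_le_towerArg m hℓ)

/-- The base case is treated separately, since the threshold is a product of `m` numbers of types
and the towers of height one do not absorb a factor `m` in the exponent. -/
lemma threshold_typeCount_zero_le (m : ℕ) {ℓ : ℕ} (hℓ : 1 ≤ ℓ) :
    (threshold (typeCount 0) m ℓ : ℝ) ≤ 2 ^ towerArg m ℓ := by
  induction m generalizing ℓ with
  | zero =>
    rw [threshold]
    have := Real.rpow_le_rpow_of_exponent_le (x := 2) one_le_two (one_le_towerArg 0 hℓ)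
    rw [Real.rpow_one] at this
    exact_mod_cast this
  | succ m ih =>
    have h1 := logb_two_natCast_nonneg hℓ
    rw [threshold, typeCount, Nat.cast_mul]
    have h2 := ih (ℓ := ℓ * 2) (by omega)
    have h3 := natCast_eq_two_rpow (ℓ := ℓ * 2) (by omega)
    calc ((ℓ * 2 : ℕ) : ℝ) * threshold (typeCount 0) m (ℓ * 2)
        ≤ 2 ^ Real.logb 2 ((ℓ * 2 : ℕ) : ℝ) * 2 ^ towerArg m (ℓ * 2) :=
          mul_le_mul h3.le h2 (Nat.cast_nonneg _) (by positivity)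
      _ = 2 ^ (Real.logb 2 ((ℓ * 2 : ℕ) : ℝ) + towerArg m (ℓ * 2)) := by
          rw [← Real.rpow_add two_pos]
      _ ≤ 2 ^ towerArg (m + 1) ℓ := by
          refine Real.rpow_le_rpow_of_exponent_le one_le_two ?_
          rw [towerArg, towerArg, logb_two_mul_two hℓ]
          push_cast
          nlinarith

/-- A threshold is a product of `m` numbers of types and the factor two, each at most `2 ^ Z`. -/
lemma threshold_le {N : ℕ → ℕ → ℕ} {Y Z : ℝ} (hZ : 1 ≤ Z)
    (hN : ∀ m ℓ, 1 ≤ ℓ → towerArg m ℓ ≤ Y → (N m ℓ : ℝ) ≤ 2 ^ Z) (m : ℕ) {ℓ : ℕ} (hℓ : 1 ≤ ℓ)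
    (hY : towerArg m ℓ ≤ Y) : (threshold N m ℓ : ℝ) ≤ 2 ^ (((m : ℝ) + 1) * Z) := by
  induction m generalizing ℓ with
  | zero =>
    rw [threshold, Nat.cast_zero, zero_add, one_mul]
    have := Real.rpow_le_rpow_of_exponent_le (x := 2) one_le_two hZ
    rw [Real.rpow_one] at this
    exact_mod_cast this
  | succ m ih =>
    have hY' := (towerArg_mul_two_le m hℓ).trans hY
    rw [threshold, Nat.cast_mul]
    calc (N m (ℓ * 2) : ℝ) * threshold N m (ℓ * 2) ≤ 2 ^ Z * 2 ^ (((m : ℝ) + 1) * Z) :=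
          mul_le_mul (hN m _ (by omega) hY') (ih (by omega) hY') (Nat.cast_nonneg _)
            (by positivity)
      _ = 2 ^ (((m + 1 : ℕ) + 1 : ℝ) * Z) := by
          rw [← Real.rpow_add two_pos]
          push_cast
          ring_nf

/-- One step of the recursion for the numbers of types adds one exponential. -/
lemma typeCount_succ_le {j m ℓ : ℕ} {Z : ℝ} (hZ : 1 ≤ Z) (hℓ : (ℓ : ℝ) ≤ 2 ^ Z)
    (hN : (typeCount j m ℓ : ℝ) ≤ 2 ^ Z) (hT : (threshold (typeCount j) m ℓ : ℝ) ≤ 2 ^ Z) :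
    (typeCount (j + 1) m ℓ : ℝ) ≤ 2 ^ ((2 : ℝ) ^ (4 * Z)) := by
  have h1 : (1 : ℝ) ≤ 2 ^ Z := Real.one_le_rpow one_le_two (by linarith)
  have h2 : (2 : ℝ) ≤ 2 ^ Z := by
    have := Real.rpow_le_rpow_of_exponent_le (x := 2) one_le_two hZ
    rwa [Real.rpow_one] at this
  have h3 : (threshold (typeCount j) m ℓ : ℝ) + 1 ≤ 2 ^ (2 * Z) := by
    rw [two_mul, Real.rpow_add two_pos]
    nlinarith
  have h4 : ((threshold (typeCount j) m ℓ : ℝ) + 1) ^ typeCount j m ℓ ≤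
      2 ^ (2 * Z * 2 ^ Z) := by
    calc ((threshold (typeCount j) m ℓ : ℝ) + 1) ^ typeCount j m ℓ
        ≤ ((2 : ℝ) ^ (2 * Z)) ^ typeCount j m ℓ := by gcongr
      _ = 2 ^ (2 * Z * typeCount j m ℓ) := by
          rw [← Real.rpow_natCast, ← Real.rpow_mul zero_le_two]
      _ ≤ 2 ^ (2 * Z * 2 ^ Z) := by
          refine Real.rpow_le_rpow_of_exponent_le one_le_two ?_
          gcongr
  have h5 : 3 * Z ≤ 2 ^ (3 * Z) := by
    have := add_one_le_two_rpow (x := 3 * Z) (by linarith)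
    linarith
  rw [typeCount]
  push_cast
  calc (ℓ : ℝ) * ((threshold (typeCount j) m ℓ : ℝ) + 1) ^ typeCount j m ℓ
      ≤ 2 ^ Z * 2 ^ (2 * Z * 2 ^ Z) := mul_le_mul hℓ h4 (by positivity) (by positivity)
    _ = 2 ^ (Z + 2 * Z * 2 ^ Z) := by rw [← Real.rpow_add two_pos]
    _ ≤ 2 ^ ((2 : ℝ) ^ (4 * Z)) := by
        refine Real.rpow_le_rpow_of_exponent_le one_le_two ?_
        calc Z + 2 * Z * 2 ^ Z ≤ 3 * Z * 2 ^ Z := by nlinarith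
          _ ≤ 2 ^ (3 * Z) * 2 ^ Z := by gcongr
          _ = 2 ^ (4 * Z) := by
              rw [← Real.rpow_add two_pos]
              ring_nf

/-- The numbers of types and the thresholds are bounded by towers. -/
theorem typeCount_and_threshold_le (j m : ℕ) {ℓ : ℕ} (hℓ : 1 ≤ ℓ) :
    (typeCount j m ℓ : ℝ) ≤ tower (j + 1) ((8 ^ j : ℕ) * towerArg m ℓ) ∧
      (threshold (typeCount j) m ℓ : ℝ) ≤ tower (j + 1) ((8 ^ j : ℕ) * towerArg m ℓ) := by
  induction j generalizing m ℓ with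
  | zero =>
    rw [pow_zero, Nat.cast_one, one_mul, tower, tower]
    exact ⟨natCast_le_two_rpow_towerArg m hℓ, threshold_typeCount_zero_le m hℓ⟩
  | succ j ih =>
    have h8 : (1 : ℝ) ≤ (8 ^ j : ℕ) := by exact_mod_cast Nat.one_le_pow _ _ (by norm_num)
    have harg : ∀ m {ℓ : ℕ}, 1 ≤ ℓ → towerArg m ℓ ≤ (8 ^ j : ℕ) * towerArg m ℓ := fun m ℓ hℓ =>
      le_mul_of_one_le_left (by linarith [one_le_towerArg m hℓ]) h8
    have hone : ∀ m {ℓ : ℕ}, 1 ≤ ℓ → 1 ≤ (8 ^ j : ℕ) * towerArg m ℓ := fun m ℓ hℓ =>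
      (one_le_towerArg m hℓ).trans (harg m hℓ)
    have hcount : ∀ m {ℓ : ℕ}, 1 ≤ ℓ → (typeCount (j + 1) m ℓ : ℝ) ≤
        tower (j + 2) ((4 : ℕ) * ((8 ^ j : ℕ) * towerArg m ℓ)) := by
      intro m ℓ hℓ
      have hZ := le_tower j (hone m hℓ)
      have h1 := typeCount_succ_le ((hone m hℓ).trans hZ)
        ((natCast_le_two_rpow_towerArg m hℓ).trans
          (Real.rpow_le_rpow_of_exponent_le one_le_two ((harg m hℓ).trans hZ)))
        (ih m hℓ).1 (ih m hℓ).2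
      refine h1.trans ?_
      rw [tower, tower]
      refine Real.rpow_le_rpow_of_exponent_le one_le_two
        (Real.rpow_le_rpow_of_exponent_le one_le_two ?_)
      exact_mod_cast natCast_mul_tower_le j (c := 4) (by norm_num) (hone m hℓ)
    set x : ℝ := (4 : ℕ) * ((8 ^ j : ℕ) * towerArg m ℓ) with hx
    have hx1 : (8 ^ j : ℕ) * towerArg m ℓ ≤ x := by
      have := hone m hℓ
      rw [hx]
      push_cast at this ⊢
      linarith
    have hx0 : 1 ≤ x := (hone m hℓ).trans hx1
    have hx2 : ((8 ^ (j + 1) : ℕ) : ℝ) * towerArg m ℓ = (2 : ℕ) * x := by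
      rw [hx]
      push_cast
      ring
    rw [hx2]
    constructor
    · have h1 : x ≤ (2 : ℕ) * x := by
        push_cast
        linarith
      exact (hcount m hℓ).trans (tower_mono _ h1)
    · have hZ : 1 ≤ tower (j + 1) x := hx0.trans (le_tower _ hx0)
      have h1 := threshold_le (N := typeCount (j + 1)) hZ (fun m' ℓ' hℓ' hY => by
        refine (hcount m' hℓ').trans (tower_mono (j + 2) ?_)
        rw [hx]
        gcongr) m hℓ le_rfl
      refine h1.trans ?_
      conv_rhs => rw [tower]
      refine Real.rpow_le_rpow_of_exponent_le one_le_two ?_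
      have h2 : (m : ℝ) + 1 ≤ 2 ^ tower j x := by
        have h3 := add_one_le_towerArg m hℓ
        have h4 := (harg m hℓ).trans hx1
        have h5 := le_tower (j + 1) hx0
        rw [tower] at h5
        linarith
      calc ((m : ℝ) + 1) * tower (j + 1) x ≤ 2 ^ tower j x * 2 ^ tower j x := by
            rw [tower]
            gcongr
        _ = 2 ^ ((2 : ℕ) * tower j x) := by
            rw [← Real.rpow_add two_pos]
            push_cast
            ring_nf
        _ ≤ tower (j + 1) ((2 : ℕ) * x) := by
            rw [tower]
            exact Real.rpow_le_rpow_of_exponent_le one_le_two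
              (natCast_mul_tower_le j (by norm_num) hx0)

/-- The factor `g d` in the argument of the towers. Each level contributes a factor `8`
(`typeCount_and_threshold_le`), taking the `d`-th power in the bound for the number of nodes
contributes `3 * d`, and the passage from `towerArg` to the argument of `zeta` contributes `2`. -/
def zetaFactor (d : ℕ) : ℕ := 6 * (d + 1) * 8 ^ d

lemma strictMono_zetaFactor : StrictMono zetaFactor := by
  refine strictMono_nat_of_lt_succ fun d => ?_
  rw [zetaFactor, zetaFactor, pow_succ]
  have : 0 < 8 ^ d := by positivity
  nlinarith

lemma towerArg_le (p : ℕ) {m : ℕ} (hm : 1 ≤ m) (hp : 1 ≤ p) :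
    towerArg m p ≤ 2 * (((m : ℝ) + 1) * (m + Real.logb 2 p)) := by
  have := logb_two_natCast_nonneg hp
  have hm : (1 : ℝ) ≤ m := by exact_mod_cast hm
  rw [towerArg]
  nlinarith

lemma mul_towerArg_le {a d p m : ℕ} (hm : 1 ≤ m) (hp : 1 ≤ p) (h : a * 2 ≤ zetaFactor d) :
    (a : ℝ) * towerArg m p ≤ zetaFactor d * ((m : ℝ) + 1) * (m + Real.logb 2 p) := by
  have h1 := towerArg_le p hm hp
  have h2 : (a : ℝ) * 2 ≤ zetaFactor d := by exact_mod_cast h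
  have h3 := logb_two_natCast_nonneg hp
  calc (a : ℝ) * towerArg m p ≤ a * (2 * (((m : ℝ) + 1) * (m + Real.logb 2 p))) := by gcongr
    _ = a * 2 * (((m : ℝ) + 1) * (m + Real.logb 2 p)) := by ring
    _ ≤ zetaFactor d * (((m : ℝ) + 1) * (m + Real.logb 2 p)) := by gcongr
    _ = zetaFactor d * ((m : ℝ) + 1) * (m + Real.logb 2 p) := by ring

lemma typeCount_le_zeta {d p m : ℕ} (hm : 1 ≤ m) (hp : 1 ≤ p) :
    (typeCount d m p : ℝ) ≤ zeta zetaFactor d p m (d + 1) := by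
  refine (typeCount_and_threshold_le d m hp).1.trans (tower_mono _ (mul_towerArg_le hm hp ?_))
  rw [zetaFactor]
  have : 0 < 8 ^ d := by positivity
  nlinarith

/-- The bound for the numbers of children that are kept leads to the bound for the number of nodes
of the small subtree. -/
lemma exists_bound_pow_le_zeta {d p m : ℕ} (hm : 1 ≤ m) (hp : 1 ≤ p) :
    ∃ B : ℕ, (∀ j < d, typeCount j m p * levelThreshold m p j ≤ B) ∧
      (((B + 1) ^ d : ℕ) : ℝ) ≤ zeta zetaFactor d p m d := by
  cases d with
  | zero =>
    refine ⟨0, fun j hj => absurd hj (Nat.not_lt_zero j), ?_⟩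
    have h1 := mul_towerArg_le (a := 1) (d := 0) hm hp (by rw [zetaFactor]; norm_num)
    have h2 := one_le_towerArg m hp
    rw [zeta, tower]
    push_cast at h1 ⊢
    linarith
  | succ e =>
    have h8 : (1 : ℝ) ≤ (8 ^ e : ℕ) := by exact_mod_cast Nat.one_le_pow _ _ (by norm_num)
    have harg := one_le_towerArg m hp
    have hone : 1 ≤ (8 ^ e : ℕ) * towerArg m p := by nlinarith
    set Z := tower e ((8 ^ e : ℕ) * towerArg m p) with hZ
    have hZ1 : 1 ≤ Z := hone.trans (le_tower e hone)
    have hbound : ∀ j < e + 1, tower (j + 1) ((8 ^ j : ℕ) * towerArg m p) ≤ 2 ^ Z := by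
      intro j hj
      have h1 : ((8 ^ j : ℕ) : ℝ) ≤ (8 ^ e : ℕ) := by
        exact_mod_cast Nat.pow_le_pow_right (by norm_num) (by omega)
      refine (tower_mono (j + 1) (mul_le_mul_of_nonneg_right h1 (by linarith))).trans ?_
      exact tower_le_tower_of_le (Nat.succ_le_of_lt hj) hone
    refine ⟨⌊(2 : ℝ) ^ (2 * Z)⌋₊, fun j hj => Nat.le_floor ?_, ?_⟩
    · have h1 := (typeCount_and_threshold_le j m hp).1.trans (hbound j hj)
      have h2 := (typeCount_and_threshold_le j m hp).2.trans (hbound j hj)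
      rw [two_mul, Real.rpow_add two_pos, Nat.cast_mul, levelThreshold]
      gcongr
    · have h1 : (⌊(2 : ℝ) ^ (2 * Z)⌋₊ : ℝ) + 1 ≤ 2 ^ (3 * Z) := by
        have h2 : (⌊(2 : ℝ) ^ (2 * Z)⌋₊ : ℝ) ≤ 2 ^ (2 * Z) := Nat.floor_le (by positivity)
        have h3 : (1 : ℝ) ≤ 2 ^ (2 * Z) := Real.one_le_rpow one_le_two (by linarith)
        have h4 : (2 : ℝ) ≤ 2 ^ Z := by
          have := Real.rpow_le_rpow_of_exponent_le (x := 2) one_le_two hZ1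
          rwa [Real.rpow_one] at this
        have h5 : (2 : ℝ) ^ (3 * Z) = 2 ^ (2 * Z) * 2 ^ Z := by
          rw [← Real.rpow_add two_pos]
          ring_nf
        nlinarith
      calc (((⌊(2 : ℝ) ^ (2 * Z)⌋₊ + 1) ^ (e + 1) : ℕ) : ℝ)
          = ((⌊(2 : ℝ) ^ (2 * Z)⌋₊ : ℝ) + 1) ^ (e + 1) := by push_cast; rfl
        _ ≤ ((2 : ℝ) ^ (3 * Z)) ^ (e + 1) := by gcongr
        _ = 2 ^ (((3 * (e + 1) : ℕ) : ℝ) * Z) := by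
            rw [← Real.rpow_natCast, ← Real.rpow_mul zero_le_two]
            push_cast
            ring_nf
        _ ≤ tower (e + 1) ((3 * (e + 1) : ℕ) * ((8 ^ e : ℕ) * towerArg m p)) := by
            rw [tower]
            exact Real.rpow_le_rpow_of_exponent_le one_le_two
              (natCast_mul_tower_le e (by omega) hone)
        _ ≤ zeta zetaFactor (e + 1) p m (e + 1) := by
            rw [← mul_assoc, ← Nat.cast_mul]
            refine tower_mono _ (mul_towerArg_le hm hp ?_)
            rw [zetaFactor, pow_succ]
            have : 0 < 8 ^ e := by positivity
            nlinarith

/-! ### The equivalence classes and the theorem -/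

namespace LabeledTree

variable {p : ℕ}

lemma isEmpty_of_label_zero (t : LabeledTree.{u} 0) : False := (t.label t.root).elim0

/-- The one-node tree of label `i`. -/
def oneNode (i : Fin p) : LabeledTree.{u} p where
  V := PUnit
  graph := ⊥
  isTree := SimpleGraph.IsTree.of_subsingleton
  root := PUnit.unit
  label _ := i

lemma height_oneNode_le (i : Fin p) (d : ℕ) : (oneNode.{u} i).height ≤ (d : ℕ∞) := by
  refine iSup_le fun v => ?_
  rw [depth_eq_zero_iff.2 (show v = (oneNode i).root from rfl)]
  exact zero_le

/-- One-node trees of different labels differ on a sentence of rank one. -/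
lemma eq_of_msoEquiv_oneNode {m : ℕ} (hm : 1 ≤ m) {i i' : Fin p}
    (h : MSOEquiv m (oneNode.{u} i) (oneNode i')) : i = i' := by
  have h1 := h (.exElem (.label i 0)) hm
  obtain ⟨v, hv⟩ := h1.1 ⟨PUnit.unit, rfl⟩
  exact hv.symm

/-- The counting type of a representative of an equivalence class. -/
noncomputable def classType (m d p : ℕ) (q : MSOClasses.{u} m d p) :
    CountType (levelThreshold m p) (Fin p) d :=
  q.out.1.countType (levelThreshold m p) q.out.1.label d q.out.1.root

lemma classType_injective (m d p : ℕ) : Function.Injective (classType.{u} m d p) := by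
  intro q q' h
  have h1 : (msoSetoid.{u} m d p).r q.out q'.out :=
    msoEquiv_of_countType_eq q.out.2 q'.out.2 h
  rw [← Quotient.out_eq q, ← Quotient.out_eq q']
  exact Quotient.sound h1

instance finite_msoClasses (m d p : ℕ) : Finite (MSOClasses.{u} m d p) :=
  Finite.of_injective _ (classType_injective m d p)

lemma card_msoClasses_le (m d p : ℕ) : Nat.card (MSOClasses.{u} m d p) ≤ typeCount d m p := by
  have h1 := Nat.card_le_card_of_injective _ (classType_injective.{u} m d p)
  have h2 := card_countType m (Fin p) d
  rw [Fintype.card_fin] at h2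
  rwa [← h2, ← Nat.card_eq_fintype_card (α := CountType _ _ _)]

lemma le_card_msoClasses {m : ℕ} (hm : 1 ≤ m) (d p : ℕ) :
    p ≤ Nat.card (MSOClasses.{u} m d p) := by
  let F : Fin p → MSOClasses.{u} m d p := fun i =>
    Quotient.mk (msoSetoid m d p) ⟨oneNode i, height_oneNode_le i d⟩
  have hF : Function.Injective F := fun i i' h =>
    eq_of_msoEquiv_oneNode hm (Quotient.exact h)
  simpa using Nat.card_le_card_of_injective F hF

end LabeledTree

theorem mainTheorem2 :
    ∃ g : ℕ → ℕ, StrictMono g ∧ ∀ d p m : ℕ, 1 ≤ m →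
      (∀ t : LabeledTree.{u} p, t.height ≤ (d : ℕ∞) →
        ∃ s : t.Subtree, s.IsLeafHereditary ∧
          s.toTree.height = t.height ∧
          (s.nodes.Finite ∧ (s.nodes.ncard : ℝ) ≤ zeta g d p m d) ∧
          LabeledTree.MSOEquiv m s.toTree t) ∧
      Finite (LabeledTree.MSOClasses.{u} m d p) ∧
      (1 ≤ d → (Nat.card (LabeledTree.MSOClasses.{u} m d p) : ℝ) ≤ zeta g d p m (d + 1)) ∧
      (d = 0 → Nat.card (LabeledTree.MSOClasses.{u} m d p) = p) := by
  refine ⟨zetaFactor, strictMono_zetaFactor, fun d p m hm => ⟨fun t ht => ?_,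
    LabeledTree.finite_msoClasses m d p, fun _ => ?_, ?_⟩⟩
  · have hp : 1 ≤ p := Fin.pos (t.label t.root)
    obtain ⟨B, hB, hBz⟩ := exists_bound_pow_le_zeta (d := d) hm hp
    have hcard := card_countType m (Fin p)
    rw [Fintype.card_fin] at hcard
    obtain ⟨s, h1, h2, h3, h4, h5⟩ := LabeledTree.exists_subtree_countType_eq
      (T := levelThreshold m p) (fun j => one_le_two.trans (two_le_levelThreshold m hp j))
      t.label ht (B := B) (fun j hj => by rw [hcard]; exact hB j hj)
    refine ⟨s, h1, h2, ⟨h3, le_trans (by exact_mod_cast h4) hBz⟩, ?_⟩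
    exact LabeledTree.msoEquiv_of_countType_eq (h2.trans_le ht) ht h5
  -- Every tree has a root, and hence a label, so there are no trees for `p = 0`.
  · rcases Nat.eq_zero_or_pos p with rfl | hp
    · have : IsEmpty (LabeledTree.MSOClasses.{u} m d 0) :=
        ⟨fun q => q.out.1.isEmpty_of_label_zero⟩
      rw [Nat.card_of_isEmpty, Nat.cast_zero, zeta, tower]
      positivity
    · exact le_trans (by exact_mod_cast LabeledTree.card_msoClasses_le m d p)
        (typeCount_le_zeta hm hp)
  · rintro rfl
    exact le_antisymm (LabeledTree.card_msoClasses_le m 0 p) (LabeledTree.le_card_msoClasses hm 0 p)
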